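/- Fix $\alpha>0$. Let $\Psi:\mathbb R\to[0,\infty)$ be the even function with $$\Psi(y)=\begin{cases}\alpha y^2-\tfrac13y^3,&0\le y<\alpha,\\ \tfrac23\alpha^3+\alpha^2(y-\alpha)+(y-\alpha)^3,&y\ge\alpha,\end{cases}$$ let $\mathcal L^\Psi$ be the Orlicz space of measurable $f:\mathbb R\to\mathbb R$ with $\int_{\mathbb R}\Psi(cf)\,dx<\infty$ for some $c>0$ (it is contained in $L^2(\mathbb R)$), and let $N_\Psi(f)=\inf\{\lambda>0:\int_{\mathbb R}\Psi(f/\lambda)\,dx\le1\}$ be its gauge norm. Let $f\mapsto K_{1/4}*f$ be the operator on $L^2(\mathbb R)$ with Fourier symbol $\left(\frac{\tanh\xi}{\xi}\right)^{1/4}$, where $\hat f(\xi)=\int_{\mathbb R} f(x)e^{-ix\xi}\,dx$. For $l\in\mathbb N$, a local maximiser $f_l$ is a function that maximises $\|K_{1/4}*f\|_{L^2}$ among all $f\in\mathcal L^\Psi$ with $N_\Psi(f)=1$ that vanish almost everywhere outside $[-2^l,2^l]$. Then $B=\frac{4}{\sqrt3}\cos\left(\frac{5\pi}{18}\right)\alpha\approx1.48\,\alpha$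 is the unique solution $y>0$ of $2\Psi(y)=y\Psi'(y)$. Moreover, for every $\varepsilon>0$ there is an $l_0$, depending only on $\varepsilon$ and $\alpha$, such that for all $l>l_0$ every local maximiser $f_l$ satisfies $$\int_{\{f_l\ge B\}}|f_l-B|\,dx<\varepsilon .$$ -/

import Mathlib

/-!
A maximiser `f` with too much mass above `B = heightB a` can be improved. First replace `f` by
`(|f| - δ)₊`, whose support has measure at most `∫ f² / δ²`, and close the gaps of this support:
moving points together raises every Gaussian interaction energy, and the new support is bounded
independently of `l`. Then cut the function at height `B` while stretching the line by the density
`p = 1 + 2 (f - B)₊ / B`. This increases no Dirichlet form, so for a symbol `m` that is a mixture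
of Gaussians the energy drops by at most `m 0` times the drop of `∫ f²`. The symbol
`(tanh ξ / ξ) ^ (1 / 2)` is such a mixture: the partial sums of the Mittag-Leffler series of
`ξ coth ξ` are of the form `C (1 - M)` with `M` a mixture, and `(1 - M) ^ (-s)` is a power series
in `M` with nonnegative coefficients.

Because `2 Ψ(B) = B Ψ'(B)`, the density `p` compensates both `∫ f²` and `∫ Ψ(f)` to first order in
`(f - B)₊`. To second order `∫ Ψ(f)` decreases more than `∫ f²` does, in the ratio in which the
two matter for the energy; this ratio is known since low and wide plateaus show that the maximal
energy squared is asymptotically at least `1 / a`. Dilating until the modular is one again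
multiplies the energy squared by at least the dilation factor, which contradicts maximality.
-/

open MeasureTheory Filter Set
open scoped ENNReal FourierTransform

/-- The even Young function `Ψ` with parameter `a`, given on the positive half-line by
`a y² - y³/3` for `y < a` and `2a³/3 + a²(y - a) + (y - a)³` for `y ≥ a`. -/
noncomputable def youngPsi (a y : ℝ) : ℝ :=
  if |y| < a then a * |y| ^ 2 - |y| ^ 3 / 3
  else 2 / 3 * a ^ 3 + a ^ 2 * (|y| - a) + (|y| - a) ^ 3

/-- The modular `∫ Ψ(f) dx`, as an extended nonnegative number (so it is `∞` exactly when the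
nonnegative function `Ψ(f)` is not integrable). -/
noncomputable def modular (a : ℝ) (f : ℝ → ℝ) : ℝ≥0∞ :=
  ∫⁻ x, ENNReal.ofReal (youngPsi a (f x))

/-- Membership in the Orlicz space of `Ψ`: `f` is measurable (up to a null set) and
`∫ Ψ(c f) dx < ∞` for some `c > 0`. -/
def MemOrlicz (a : ℝ) (f : ℝ → ℝ) : Prop :=
  AEStronglyMeasurable f ∧ ∃ c : ℝ, 0 < c ∧ modular a (fun x => c * f x) < ∞

/-- The gauge (Minkowski, Luxemburg) norm `inf {r > 0 : ∫ Ψ(f / r) dx ≤ 1}`. -/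
noncomputable def gaugeNorm (a : ℝ) (f : ℝ → ℝ) : ℝ :=
  sInf {r : ℝ | 0 < r ∧ modular a (fun x => f x / r) ≤ 1}

/-- The symbol `(tanh ξ / ξ) ^ s`, with its continuous value `1` at `ξ = 0`. It is the Fourier
transform `∫ K_s(x) e^{-i x ξ} dx` of the kernel `K_s`. -/
noncomputable def whithamSymbol (s ξ : ℝ) : ℝ :=
  if ξ = 0 then 1 else (Real.tanh ξ / ξ) ^ s

theorem tanh_div_self_mem {x : ℝ} (hx : x ≠ 0) :
    0 ≤ Real.tanh x / x ∧ Real.tanh x / x ≤ 1 := by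
  have key : ∀ y : ℝ, 0 < y → 0 ≤ Real.tanh y / y ∧ Real.tanh y / y ≤ 1 := by
    intro y hy
    have hc := Real.cosh_pos y
    have hs : Real.sinh y ≤ y * Real.cosh y := by
      have hmono : MonotoneOn (fun t : ℝ => t * Real.cosh t - Real.sinh t) (Ici 0) := by
        apply monotoneOn_of_deriv_nonneg (convex_Ici 0)
        · fun_prop
        · fun_prop
        · intro t ht
          rw [interior_Ici] at ht
          have hd : HasDerivAt (fun t : ℝ => t * Real.cosh t - Real.sinh t)
              (1 * Real.cosh t + t * Real.sinh t - Real.cosh t) t :=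
            ((hasDerivAt_id t).mul (Real.hasDerivAt_cosh t)).sub (Real.hasDerivAt_sinh t)
          rw [hd.deriv]
          have := mul_nonneg (le_of_lt ht) (Real.sinh_nonneg_iff.2 (le_of_lt ht))
          linarith
      have h := hmono (self_mem_Ici) (mem_Ici.2 hy.le) hy.le
      simp at h
      linarith
    rw [Real.tanh_eq_sinh_div_cosh]
    have h0 : 0 ≤ Real.sinh y := Real.sinh_nonneg_iff.2 hy.le
    refine ⟨by positivity, ?_⟩
    rw [div_div, div_le_one (by positivity)]
    linarith
  rcases lt_or_gt_of_ne hx with h | h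
  · have := key (-x) (by linarith)
    rwa [Real.tanh_neg, neg_div_neg_eq] at this
  · exact key x h

theorem abs_whithamSymbol_le_one {s : ℝ} (hs : 0 ≤ s) (ξ : ℝ) : |whithamSymbol s ξ| ≤ 1 := by
  unfold whithamSymbol
  split_ifs with h
  · simp
  · obtain ⟨h0, h1⟩ := tanh_div_self_mem h
    rw [abs_of_nonneg (Real.rpow_nonneg h0 s)]
    exact Real.rpow_le_one h0 h1 hs

theorem measurable_whithamSymbol (s : ℝ) : Measurable (whithamSymbol s) := by
  unfold whithamSymbol
  have ht : Measurable Real.tanh := by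
    have : Real.tanh = fun x => Real.sinh x / Real.cosh x :=
      funext Real.tanh_eq_sinh_div_cosh
    rw [this]
    exact Real.measurable_sinh.div Real.measurable_cosh
  exact Measurable.ite (measurableSet_singleton 0) measurable_const
    ((ht.div measurable_id).pow_const s)

theorem memLp_whithamSymbol_mul {s : ℝ} (hs : 0 ≤ s) (F : Lp ℂ 2 (volume : Measure ℝ)) :
    MemLp (fun w : ℝ => (whithamSymbol s (2 * Real.pi * w) : ℂ) * F w) 2 := by
  have hm : Measurable (fun w : ℝ => (whithamSymbol s (2 * Real.pi * w) : ℂ)) :=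
    Complex.measurable_ofReal.comp
      ((measurable_whithamSymbol s).comp (measurable_const.mul measurable_id))
  refine (Lp.memLp F).of_le (hm.aestronglyMeasurable.mul (Lp.aestronglyMeasurable F)) ?_
  refine Eventually.of_forall fun w => ?_
  rw [norm_mul, Complex.norm_real, Real.norm_eq_abs]
  exact mul_le_of_le_one_left (norm_nonneg _) (abs_whithamSymbol_le_one hs _)

/-- The convolution operator `f ↦ K_s ∗ f` on `L²(ℝ)`, where the kernel `K_s` is the inverse
Fourier transform of `(tanh ξ / ξ) ^ s`: the operator with Fourier symbol `(tanh ξ / ξ) ^ s`.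
The Fourier transform `𝓕` used here has the phase `e^{-2π i x w}`, so the frequency is
`ξ = 2π w`. -/
noncomputable def whithamConv (s : ℝ) (hs : 0 ≤ s) (f : Lp ℂ 2 (volume : Measure ℝ)) :
    Lp ℂ 2 (volume : Measure ℝ) :=
  𝓕⁻ ((memLp_whithamSymbol_mul hs (𝓕 f)).toLp)

theorem third_mul_sq_le_youngPsi {a : ℝ} (ha : 0 < a) (y : ℝ) :
    a / 3 * y ^ 2 ≤ youngPsi a y := by
  unfold youngPsi
  rw [← sq_abs y]
  have h0 := abs_nonneg y
  generalize |y| = t at *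
  split_ifs with h
  · nlinarith [mul_nonneg (sq_nonneg t) (sub_nonneg.2 h.le), sq_nonneg t,
      mul_nonneg ha.le (sq_nonneg t)]
  · obtain ⟨u, rfl⟩ : ∃ u, t = a + u := ⟨t - a, by ring⟩
    have hu : 0 ≤ u := by linarith
    have : a + u - a = u := by ring
    rw [this]
    nlinarith [mul_nonneg hu (sq_nonneg (a - u)), mul_nonneg ha.le (sq_nonneg u),
      pow_pos ha 3, pow_nonneg hu 3, mul_nonneg (sq_nonneg a) hu]

/-- The Orlicz space of `Ψ` is contained in `L²`. -/
theorem MemOrlicz.memLp_two {a : ℝ} (ha : 0 < a) {f : ℝ → ℝ} (hf : MemOrlicz a f) :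
    MemLp f 2 := by
  obtain ⟨hm, c, hc, hfin⟩ := hf
  rw [memLp_two_iff_integrable_sq hm]
  have hK : 0 < a / 3 * c ^ 2 := by positivity
  have h1 : Integrable (fun x => a / 3 * c ^ 2 * f x ^ 2) := by
    refine ⟨(hm.pow 2).const_mul _, ?_⟩
    rw [hasFiniteIntegral_iff_ofReal (Eventually.of_forall fun x => by positivity)]
    refine lt_of_le_of_lt (lintegral_mono fun x => ENNReal.ofReal_le_ofReal ?_) hfin
    have := third_mul_sq_le_youngPsi ha (c * f x)
    calc a / 3 * c ^ 2 * f x ^ 2 = a / 3 * (c * f x) ^ 2 := by ring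
      _ ≤ _ := this
  have h2 := h1.const_mul (a / 3 * c ^ 2)⁻¹
  refine h2.congr (Eventually.of_forall fun x => ?_)
  simp only
  rw [← mul_assoc, inv_mul_cancel₀ hK.ne', one_mul]

open Classical in
/-- The functional `𝓙(f) = ‖K_{1/4} ∗ f‖_{L²}` of a real function `f ∈ L²(ℝ)`. It is evaluated
only on the Orlicz space of `Ψ`, which is contained in `L²`. -/
noncomputable def dispersiveEnergy (f : ℝ → ℝ) : ℝ :=
  if hf : MemLp (fun x => (f x : ℂ)) 2 (volume : Measure ℝ) then
    ‖whithamConv (1 / 4) (by norm_num) hf.toLp‖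
  else 0

/-- The constraint of the local problem on `[-2^l, 2^l]`: `f` lies in the Orlicz space of `Ψ`,
has gauge norm one, and vanishes (almost everywhere) outside `[-2^l, 2^l]`. -/
def localConstraint (a : ℝ) (l : ℕ) : Set (ℝ → ℝ) :=
  {f | MemOrlicz a f ∧ gaugeNorm a f = 1 ∧
    ∀ᵐ x : ℝ, x ∉ Icc (-(2 : ℝ) ^ l) ((2 : ℝ) ^ l) → f x = 0}

/-- `f` is a maximiser of `𝓙` under the constraint of the local problem on `[-2^l, 2^l]`. -/
def IsLocalMaximiser (a : ℝ) (l : ℕ) (f : ℝ → ℝ) : Prop :=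
  f ∈ localConstraint a l ∧ IsMaxOn dispersiveEnergy (localConstraint a l) f

/-- The height `B = (4/√3) cos(5π/18) a`. -/
noncomputable def heightB (a : ℝ) : ℝ :=
  4 / Real.sqrt 3 * Real.cos (5 * Real.pi / 18) * a

theorem youngPsi_abs (a y : ℝ) : youngPsi a |y| = youngPsi a y := by simp [youngPsi]

theorem youngPsi_zero {a : ℝ} (ha : 0 < a) : youngPsi a 0 = 0 := by simp [youngPsi, ha]

theorem youngPsi_nonneg {a : ℝ} (ha : 0 < a) (y : ℝ) : 0 ≤ youngPsi a y :=
  le_trans (by positivity) (third_mul_sq_le_youngPsi ha y)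

theorem youngPsi_of_le {a y : ℝ} (hy : 0 ≤ y) (h : a ≤ y) :
    youngPsi a y = 2 / 3 * a ^ 3 + a ^ 2 * (y - a) + (y - a) ^ 3 := by
  rw [youngPsi, abs_of_nonneg hy, if_neg h.not_gt]

theorem youngPsi_eq_abs (a y : ℝ) :
    youngPsi a y = a * |y| ^ 2 - |y| ^ 3 / 3 + 4 / 3 * max (|y| - a) 0 ^ 3 := by
  unfold youngPsi
  split_ifs with h
  · rw [max_eq_right (by linarith)]; ring
  · rw [max_eq_left (by linarith)]; ring

theorem youngPsi_of_nonneg {a y : ℝ} (hy : 0 ≤ y) :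
    youngPsi a y = a * y ^ 2 - y ^ 3 / 3 + 4 / 3 * max (y - a) 0 ^ 3 := by
  rw [youngPsi_eq_abs, abs_of_nonneg hy]

@[fun_prop]
theorem continuous_youngPsi (a : ℝ) : Continuous (youngPsi a) := by
  rw [funext (youngPsi_eq_abs a)]
  fun_prop

@[fun_prop]
theorem measurable_youngPsi (a : ℝ) : Measurable (youngPsi a) := (continuous_youngPsi a).measurable

theorem hasDerivAt_max_zero_pow_three (x : ℝ) :
    HasDerivAt (fun u : ℝ => max u 0 ^ 3) (3 * max x 0 ^ 2) x := by
  have h_eq : (fun u : ℝ => max u 0 ^ 3) = fun u => (u ^ 3 + |u| ^ (3 : ℝ)) / 2 := by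
    ext u
    rw [show (3 : ℝ) = (3 : ℕ) by norm_num, Real.rpow_natCast]
    rcases le_total u 0 with h | h
    · rw [max_eq_right h, abs_of_nonpos h]; ring
    · rw [max_eq_left h, abs_of_nonneg h]; ring
  rw [h_eq]
  refine (((hasDerivAt_pow 3 x).add (hasDerivAt_abs_rpow x (by norm_num))).div_const 2).congr_deriv
    ?_
  rw [show (3 : ℝ) - 2 = 1 by norm_num, Real.rpow_one]
  rcases le_total x 0 with h | h
  · rw [max_eq_right h, abs_of_nonpos h]; push_cast; ring
  · rw [max_eq_left h, abs_of_nonneg h]; push_cast; ring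

theorem hasDerivAt_youngPsi {a y : ℝ} (hy : 0 < y) :
    HasDerivAt (youngPsi a) (a ^ 2 - (y - a) ^ 2 + 4 * max (y - a) 0 ^ 2) y := by
  have h_cube : HasDerivAt (fun u : ℝ => max (u - a) 0 ^ 3) (3 * max (y - a) 0 ^ 2) y :=
    (hasDerivAt_max_zero_pow_three (y - a)).comp_sub_const y a
  have h_sum := (((hasDerivAt_pow 2 y).const_mul a).sub ((hasDerivAt_pow 3 y).div_const 3)).add
    (h_cube.const_mul (4 / 3))
  refine (h_sum.congr_of_eventuallyEq ?_).congr_deriv (by push_cast; ring)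
  filter_upwards [lt_mem_nhds hy] with u hu using youngPsi_of_nonneg hu.le

theorem convexOn_youngPsi (a : ℝ) : ConvexOn ℝ (Ici 0) (youngPsi a) := by
  refine MonotoneOn.convexOn_of_deriv (convex_Ici 0) (by fun_prop) ?_ ?_ <;> rw [interior_Ici]
  · exact fun y hy => (hasDerivAt_youngPsi hy).differentiableAt.differentiableWithinAt
  · intro x hx y hy hxy
    rw [(hasDerivAt_youngPsi hx).deriv, (hasDerivAt_youngPsi hy).deriv]
    rcases le_total x a with hxa | hxa <;> rcases le_total y a with hya | hya <;>
      simp only [max_eq_left, max_eq_right, sub_nonneg, sub_nonpos, hxa, hya] <;> nlinarith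

theorem mul_youngPsi_le {a t : ℝ} (ha : 0 < a) (ht : 1 ≤ t) (y : ℝ) :
    t * youngPsi a y ≤ youngPsi a (t * y) := by
  have ht0 : 0 < t := by linarith
  rw [← youngPsi_abs a y, ← youngPsi_abs a (t * y), abs_mul, abs_of_pos ht0]
  have h := (convexOn_youngPsi a).2 (x := 0) (y := t * |y|) self_mem_Ici (mem_Ici.2 (by positivity))
    (sub_nonneg.2 (inv_le_one_of_one_le₀ ht)) (by positivity) (sub_add_cancel 1 t⁻¹)
  simp only [smul_eq_mul, mul_zero, zero_add, youngPsi_zero ha, inv_mul_cancel_left₀ ht0.ne'] at h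
  rwa [inv_mul_eq_div, le_div_iff₀' ht0] at h

theorem monotoneOn_youngPsi {a : ℝ} (ha : 0 < a) : MonotoneOn (youngPsi a) (Ici 0) := by
  intro x (hx : 0 ≤ x) y _ hxy
  rcases hx.eq_or_lt with rfl | hx
  · rw [youngPsi_zero ha]; exact youngPsi_nonneg ha y
  · have h1 : 1 ≤ y / x := (one_le_div hx).2 hxy
    calc youngPsi a x ≤ y / x * youngPsi a x := le_mul_of_one_le_left (youngPsi_nonneg ha x) h1
      _ ≤ youngPsi a (y / x * x) := mul_youngPsi_le ha h1 x
      _ = youngPsi a y := by rw [div_mul_cancel₀ _ hx.ne']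

theorem youngPsi_le_mul_sq {a y : ℝ} (hy : 0 ≤ y) (hya : y ≤ a) :
    youngPsi a y ≤ a * y ^ 2 := by
  rw [youngPsi_of_nonneg hy, max_eq_right (by linarith)]
  have := pow_nonneg hy 3
  linarith

theorem sq_le_div_mul_youngPsi {a : ℝ} (ha : 0 < a) (y : ℝ) : y ^ 2 ≤ 3 / a * youngPsi a y := by
  have := third_mul_sq_le_youngPsi ha y
  rw [div_mul_eq_mul_div, le_div_iff₀ ha]
  linarith

theorem exists_youngPsi_eq {a q : ℝ} (ha : 0 < a) (hq : 0 ≤ q) (hq' : q ≤ 2 / 3 * a ^ 3) :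
    ∃ y, 0 ≤ y ∧ y ≤ a ∧ youngPsi a y = q := by
  have h_mem : q ∈ Icc (youngPsi a 0) (youngPsi a a) := by
    rw [youngPsi_zero ha, youngPsi_of_le ha.le le_rfl]
    exact ⟨hq, hq'.trans_eq (by ring)⟩
  obtain ⟨y, hy, rfl⟩ := intermediate_value_Icc ha.le (continuous_youngPsi a).continuousOn h_mem
  exact ⟨y, hy.1, hy.2, rfl⟩

-- Since `cos (3 * (5π / 18)) = -√3 / 2`, this is the triple angle formula for the cosine.
theorem heightB_cubic (a : ℝ) : heightB a ^ 3 - 4 * a ^ 2 * heightB a + 8 / 3 * a ^ 3 = 0 := by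
  have h_cos : Real.cos (3 * (5 * Real.pi / 18)) = -(√3 / 2) := by
    rw [show 3 * (5 * Real.pi / 18) = Real.pi - Real.pi / 6 by ring, Real.cos_pi_sub,
      Real.cos_pi_div_six]
  rw [Real.cos_three_mul] at h_cos
  have h_sq : √3 ^ 2 = 3 := Real.sq_sqrt (by norm_num)
  have h_cube : √3 ^ 3 = 3 * √3 := by rw [pow_succ, h_sq]
  have h_ne : √3 ≠ 0 := by positivity
  unfold heightB
  field_simp
  rw [h_cube, h_sq]
  linear_combination (48 * a ^ 3) * h_cos

theorem le_heightB {a : ℝ} (ha : 0 < a) : a ≤ heightB a := by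
  have h_cos : 1 / 2 ≤ Real.cos (5 * Real.pi / 18) := by
    rw [← Real.cos_pi_div_three]
    have := Real.pi_pos
    exact Real.cos_le_cos_of_nonneg_of_le_pi (by positivity) (by linarith) (by linarith)
  have h_sqrt : √3 ≤ 2 := Real.sqrt_le_left (by norm_num) |>.2 (by norm_num)
  refine le_mul_of_one_le_left ha.le ?_
  calc (1 : ℝ) = 4 / 2 * (1 / 2) := by norm_num
    _ ≤ 4 / √3 * Real.cos (5 * Real.pi / 18) := by gcongr

theorem heightB_bounds {a : ℝ} (ha : 0 < a) :
    1.475 * a ≤ heightB a ∧ heightB a ≤ 1.485 * a := by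
  have h_cubic := heightB_cubic a
  obtain ⟨b, hb⟩ : ∃ b, heightB a = b * a := ⟨heightB a / a, by field_simp⟩
  have hb1 : 1 ≤ b := by
    have := le_heightB ha
    rwa [hb, le_mul_iff_one_le_left ha] at this
  have hb_cubic : b ^ 3 - 4 * b + 8 / 3 = 0 := by
    rw [hb] at h_cubic
    have : a ^ 3 * (b ^ 3 - 4 * b + 8 / 3) = 0 := by linarith
    exact (mul_eq_zero.1 this).resolve_left (by positivity)
  rw [hb]
  constructor
  · gcongr
    nlinarith [mul_nonneg (sub_nonneg.2 hb1) (sub_nonneg.2 hb1)]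
  · gcongr
    by_contra! hlt
    nlinarith [mul_pos (sub_pos.2 hlt) (sub_pos.2 hlt)]

theorem heightB_pos {a : ℝ} (ha : 0 < a) : 0 < heightB a := ha.trans_le (le_heightB ha)

theorem abs_heightB_sub_le {a : ℝ} (ha : 0 < a) : |heightB a - 1.48 * a| ≤ 0.005 * a := by
  obtain ⟨h_lower, h_upper⟩ := heightB_bounds ha
  rw [abs_le]
  constructor <;> linarith

theorem two_mul_youngPsi_eq_iff {a y : ℝ} (ha : 0 < a) (hy : 0 < y) :
    2 * youngPsi a y = y * deriv (youngPsi a) y ↔ y = heightB a := by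
  have h_cubic := heightB_cubic a
  have h_lower := (heightB_bounds ha).1
  rw [(hasDerivAt_youngPsi hy).deriv, youngPsi_of_nonneg hy.le]
  rcases lt_or_ge y a with h | h
  · rw [max_eq_right (by linarith)]
    have := pow_pos hy 3
    constructor <;> intro _ <;> nlinarith
  · rw [max_eq_left (by linarith)]
    constructor
    · intro h_eq
      have h_factor :
          (y - heightB a) * (y ^ 2 + y * heightB a + heightB a ^ 2 - 4 * a ^ 2) = 0 := by
        linarith
      rcases mul_eq_zero.1 h_factor with h' | h'
      · linarith
      · nlinarith
    · intro h_eq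
      rw [← h_eq] at h_cubic
      linarith

/-- The factor by which the line is stretched where a function has height `y`, when the function
is cut off at the height `B`. It makes up to second order in `y - B` for the loss in `y ^ 2`. -/
noncomputable def stretchDensity (B y : ℝ) : ℝ := 1 + 2 / B * max (y - B) 0

@[fun_prop]
theorem measurable_stretchDensity (B : ℝ) : Measurable (stretchDensity B) := by
  unfold stretchDensity
  fun_prop

theorem one_le_stretchDensity {B : ℝ} (hB : 0 ≤ B) (y : ℝ) : 1 ≤ stretchDensity B y :=
  le_add_of_nonneg_right (by positivity)

theorem stretchDensity_of_le {B y : ℝ} (h : y ≤ B) : stretchDensity B y = 1 := by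
  rw [stretchDensity, max_eq_right (by linarith), mul_zero, add_zero]

theorem stretchDensity_mul_min_sq {B : ℝ} (hB : B ≠ 0) (y : ℝ) :
    stretchDensity B y * min y B ^ 2 = y ^ 2 - max (y - B) 0 ^ 2 := by
  rcases le_total y B with h | h
  · rw [stretchDensity_of_le h, min_eq_left h, max_eq_right (by linarith)]; ring
  · rw [stretchDensity, min_eq_right h, max_eq_left (by linarith)]; field_simp; ring

-- `2 Ψ(B) = B Ψ'(B)` says that `Ψ(B) (1 + 2 (y - B) / B)` is the tangent of `Ψ` at `B`.
theorem stretchDensity_heightB_mul_youngPsi_min {a : ℝ} (ha : 0 < a) (y : ℝ) :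
    stretchDensity (heightB a) y * youngPsi a (min y (heightB a))
      = youngPsi a y - 3 * (heightB a - a) * max (y - heightB a) 0 ^ 2
        - max (y - heightB a) 0 ^ 3 := by
  have h_cubic := heightB_cubic a
  have hBa := le_heightB ha
  have hB := heightB_pos ha
  rcases le_total y (heightB a) with h | h
  · rw [stretchDensity_of_le h, min_eq_left h, max_eq_right (by linarith)]; ring
  · rw [stretchDensity, min_eq_right h, max_eq_left (by linarith), youngPsi_of_le hB.le hBa,
      youngPsi_of_le (hB.le.trans h) (hBa.trans h)]
    field_simp
    linear_combination (-(y - heightB a) * 3) * h_cubic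

theorem stretchDensity_heightB_mul_youngPsi_min_le {a : ℝ} (ha : 0 < a) (y : ℝ) :
    stretchDensity (heightB a) y * youngPsi a (min y (heightB a)) ≤ youngPsi a y := by
  rw [stretchDensity_heightB_mul_youngPsi_min ha]
  have : 0 ≤ heightB a - a := sub_nonneg.2 (le_heightB ha)
  have : 0 ≤ 3 * (heightB a - a) * max (y - heightB a) 0 ^ 2 := by positivity
  have : 0 ≤ max (y - heightB a) 0 ^ 3 := by positivity
  linarith

theorem max_abs_sub_le_sq_div {B : ℝ} (hB : 0 < B) (y : ℝ) : max (|y| - B) 0 ≤ y ^ 2 / B := by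
  refine max_le ?_ (by positivity)
  rw [le_div_iff₀ hB, ← sq_abs y]
  nlinarith [sq_nonneg (|y| - B), abs_nonneg y]

theorem stretchDensity_le {B : ℝ} (hB : 0 < B) (y : ℝ) :
    stretchDensity B y ≤ 1 + 2 / B ^ 2 * y ^ 2 := by
  have h_max : max (y - B) 0 ≤ y ^ 2 / B :=
    (max_le_max_right 0 (sub_le_sub_right (le_abs_self y) B)).trans (max_abs_sub_le_sq_div hB y)
  calc stretchDensity B y ≤ 1 + 2 / B * (y ^ 2 / B) := by unfold stretchDensity; gcongr
    _ = 1 + 2 / B ^ 2 * y ^ 2 := by field_simp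

theorem stretchDensity_mul_sub_sq_le {B u v : ℝ} (hB : 0 < B) (hu : B ≤ u) (hv : 0 ≤ v)
    (hvB : v ≤ B) : stretchDensity B u * (B - v) ^ 2 ≤ (u - v) ^ 2 := by
  rw [stretchDensity, max_eq_left (sub_nonneg.2 hu)]
  have h_div : (B - v) * ((B - v) / B) ≤ B - v :=
    mul_le_of_le_one_right (sub_nonneg.2 hvB) ((div_le_one hB).2 (by linarith))
  calc (1 + 2 / B * (u - B)) * (B - v) ^ 2
      = (B - v) ^ 2 + 2 * (u - B) * ((B - v) * ((B - v) / B)) := by field_simp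
    _ ≤ (B - v) ^ 2 + 2 * (u - B) * (B - v) := by
        have := sub_nonneg.2 hu
        gcongr
    _ ≤ (u - v) ^ 2 := by nlinarith [sq_nonneg (u - B)]

theorem stretchDensity_mul_stretchDensity_mul_sq_le {B u v : ℝ} (hB : 0 < B) (hu : 0 ≤ u)
    (hv : 0 ≤ v) :
    stretchDensity B u * stretchDensity B v * (min u B - min v B) ^ 2 ≤ (u - v) ^ 2 := by
  rcases le_total u B with huB | huB <;> rcases le_total v B with hvB | hvB
  · rw [stretchDensity_of_le huB, stretchDensity_of_le hvB, min_eq_left huB, min_eq_left hvB,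
      one_mul, one_mul]
  · rw [stretchDensity_of_le huB, min_eq_left huB, min_eq_right hvB, one_mul, sub_sq_comm,
      sub_sq_comm u v]
    exact stretchDensity_mul_sub_sq_le hB hvB hu huB
  · rw [stretchDensity_of_le hvB, min_eq_right huB, min_eq_left hvB, mul_one]
    exact stretchDensity_mul_sub_sq_le hB huB hv hvB
  · rw [min_eq_right huB, min_eq_right hvB, sub_self, zero_pow two_ne_zero, mul_zero]
    exact sq_nonneg _

/-- The soft thresholding `(|y| - δ)₊` of `|y|`. Unlike a sharp cut-off it is a contraction, while
it still vanishes wherever `|y| ≤ δ`. -/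
noncomputable def softThreshold (δ y : ℝ) : ℝ := max (|y| - δ) 0

@[fun_prop]
theorem measurable_softThreshold (δ : ℝ) : Measurable (softThreshold δ) := by
  unfold softThreshold
  fun_prop

theorem softThreshold_nonneg (δ y : ℝ) : 0 ≤ softThreshold δ y := le_max_right _ _

theorem softThreshold_le_abs {δ : ℝ} (hδ : 0 ≤ δ) (y : ℝ) : softThreshold δ y ≤ |y| :=
  max_le (sub_le_self _ hδ) (abs_nonneg y)

theorem le_abs_of_softThreshold_ne_zero {δ y : ℝ} (h : softThreshold δ y ≠ 0) : δ ≤ |y| := by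
  contrapose! h
  exact max_eq_right (by linarith)

theorem abs_softThreshold_sub_le (δ x y : ℝ) :
    |softThreshold δ x - softThreshold δ y| ≤ |x - y| := by
  refine (abs_max_sub_max_le_abs _ _ _).trans ?_
  rw [sub_sub_sub_cancel_right]
  exact abs_abs_sub_abs_le_abs_sub x y

theorem antitoneOn_sq_sub_mul_youngPsi {a c σ : ℝ} (hc_nonneg : 0 ≤ c)
    (hc_lower : 1 - σ ≤ a * c) (hc_upper : c ≤ 3 / a) :
    AntitoneOn (fun z => z ^ 2 - c * youngPsi a z - σ * z ^ 2 - z ^ 3 / a) (Ici 0) := by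
  have h_deriv (z : ℝ) (hz : 0 < z) :=
    ((((hasDerivAt_pow 2 z).sub ((hasDerivAt_youngPsi (a := a) hz).const_mul c)).sub
      ((hasDerivAt_pow 2 z).const_mul σ)).sub ((hasDerivAt_pow 3 z).div_const a))
  refine antitoneOn_of_deriv_nonpos (convex_Ici 0) (by fun_prop) ?_ ?_ <;> rw [interior_Ici]
  · exact fun z hz => (h_deriv z hz).differentiableAt.differentiableWithinAt
  · intro z (hz : 0 < z)
    have h_linear : (1 - σ) * z ≤ a * c * z := by gcongr
    have h_quadratic : c * z ^ 2 ≤ 3 / a * z ^ 2 := by gcongr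
    have h_max : 0 ≤ c * max (z - a) 0 ^ 2 := by positivity
    refine ((h_deriv z hz).deriv).trans_le ?_
    push_cast
    rw [mul_div_right_comm]
    linarith

theorem sq_sub_mul_youngPsi_sub_softThreshold_le {a c σ δ : ℝ} (ha : 0 < a) (hc_nonneg : 0 ≤ c)
    (hc_lower : 1 - σ ≤ a * c) (hc_upper : c ≤ 3 / a) (hσ : 0 ≤ σ) (hδ : 0 ≤ δ) (y : ℝ) :
    (y ^ 2 - c * youngPsi a y)
        - (softThreshold δ y ^ 2 - c * youngPsi a (softThreshold δ y))
      ≤ (σ + 3 * δ / a) * y ^ 2 := by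
  have hv_nonneg := softThreshold_nonneg δ y
  have hv_le := softThreshold_le_abs hδ y
  have hv_ge : |y| - δ ≤ softThreshold δ y := le_max_left _ _
  have h_anti := antitoneOn_sq_sub_mul_youngPsi hc_nonneg hc_lower hc_upper
    (mem_Ici.2 hv_nonneg) (mem_Ici.2 (abs_nonneg y)) hv_le
  rw [← youngPsi_abs a y, ← sq_abs y]
  generalize softThreshold δ y = v at *
  have h_sq : σ * (|y| ^ 2 - v ^ 2) ≤ σ * |y| ^ 2 := by
    gcongr
    exact sub_le_self _ (sq_nonneg v)
  have h_cube : |y| ^ 3 - v ^ 3 ≤ 3 * δ * |y| ^ 2 := by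
    calc |y| ^ 3 - v ^ 3 = (|y| - v) * (|y| ^ 2 + |y| * v + v ^ 2) := by ring
      _ ≤ δ * (|y| ^ 2 + |y| * |y| + |y| ^ 2) := by gcongr; linarith
      _ = 3 * δ * |y| ^ 2 := by ring
  have h_cube_div : (|y| ^ 3 - v ^ 3) / a ≤ 3 * δ * |y| ^ 2 / a := by gcongr
  calc (|y| ^ 2 - c * youngPsi a |y|) - (v ^ 2 - c * youngPsi a v)
      ≤ σ * (|y| ^ 2 - v ^ 2) + (|y| ^ 3 - v ^ 3) / a := by
        rw [sub_div]
        linarith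
    _ ≤ σ * |y| ^ 2 + 3 * δ * |y| ^ 2 / a := add_le_add h_sq h_cube_div
    _ = (σ + 3 * δ / a) * |y| ^ 2 := by ring

theorem sq_sub_mul_youngPsi_add_le_stretchDensity_mul {a c σ : ℝ} (ha : 0 < a)
    (hc_nonneg : 0 ≤ c) (hc_lower : 1 - σ ≤ a * c) (hσ : σ ≤ 1 / 10) (z : ℝ) :
    z ^ 2 - c * youngPsi a z + 1 / 5 * max (z - heightB a) 0 ^ 2
      ≤ stretchDensity (heightB a) z
        * (min z (heightB a) ^ 2 - c * youngPsi a (min z (heightB a))) := by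
  have h_sq := stretchDensity_mul_min_sq (heightB_pos ha).ne' z
  have h_Psi := stretchDensity_heightB_mul_youngPsi_min ha z
  have hB := (heightB_bounds ha).1
  have h_coeff : 6 / 5 ≤ c * (3 * (heightB a - a)) :=
    calc 6 / 5 ≤ 3 * 0.475 * (1 - σ) := by linarith
      _ ≤ 3 * 0.475 * (a * c) := by gcongr
      _ = c * (3 * (1.475 * a - a)) := by ring
      _ ≤ c * (3 * (heightB a - a)) := by gcongr
  have h_quadratic : 6 / 5 * max (z - heightB a) 0 ^ 2
      ≤ c * (3 * (heightB a - a)) * max (z - heightB a) 0 ^ 2 := by gcongr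
  have h_cubic : 0 ≤ c * max (z - heightB a) 0 ^ 3 := by positivity
  rw [mul_sub, mul_left_comm, h_sq, h_Psi]
  linarith

theorem linear_sub_quadratic_le_sq_softThreshold_sub {B δ θ : ℝ} (hB : 0 < B) (hδ : 0 ≤ δ)
    (hθ : 0 ≤ θ) (y : ℝ) :
    2 * θ * max (|y| - B) 0 - (2 * θ * δ + θ ^ 2) / B ^ 2 * y ^ 2
      ≤ max (softThreshold δ y - B) 0 ^ 2 := by
  rcases le_total |y| B with h | h
  · rw [max_eq_right (by linarith), mul_zero, zero_sub]
    exact (neg_nonpos.2 (by positivity)).trans (sq_nonneg _)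
  · rw [max_eq_left (by linarith)]
    have h_one : 1 ≤ y ^ 2 / B ^ 2 := by
      rw [one_le_div (by positivity), ← sq_abs y]
      gcongr
    have h_const : 2 * θ * δ + θ ^ 2 ≤ (2 * θ * δ + θ ^ 2) / B ^ 2 * y ^ 2 := by
      rw [div_mul_eq_mul_div, mul_div_assoc]
      exact le_mul_of_one_le_right (by positivity) h_one
    have h_sub : θ * (|y| - B - δ) ≤ θ * max (softThreshold δ y - B) 0 := by
      gcongr
      have : |y| - δ ≤ softThreshold δ y := le_max_left _ _
      exact le_max_of_le_left (by linarith)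
    nlinarith [sq_nonneg (max (softThreshold δ y - B) 0 - θ)]

theorem truncation_gain {a c σ δ θ : ℝ} (ha : 0 < a) (hc_nonneg : 0 ≤ c)
    (hc_lower : 1 - σ ≤ a * c) (hc_upper : c ≤ 3 / a) (hσ : 0 ≤ σ) (hσ' : σ ≤ 1 / 10)
    (hδ : 0 ≤ δ) (hθ : 0 ≤ θ) (y : ℝ) :
    y ^ 2 - c * youngPsi a y - (σ + 3 * δ / a) * y ^ 2
      + 1 / 5 * (2 * θ * max (|y| - heightB a) 0
        - (2 * θ * δ + θ ^ 2) / heightB a ^ 2 * y ^ 2)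
    ≤ stretchDensity (heightB a) (softThreshold δ y)
      * (min (softThreshold δ y) (heightB a) ^ 2
        - c * youngPsi a (min (softThreshold δ y) (heightB a))) := by
  have h_threshold :=
    sq_sub_mul_youngPsi_sub_softThreshold_le ha hc_nonneg hc_lower hc_upper hσ hδ y
  have h_cap :=
    sq_sub_mul_youngPsi_add_le_stretchDensity_mul ha hc_nonneg hc_lower hσ' (softThreshold δ y)
  have h_mass := linear_sub_quadratic_le_sq_softThreshold_sub (heightB_pos ha) hδ hθ y
  linarith

/-- The cone of Gaussian mixtures: the smallest set of functions that contains the centred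
Gaussians and is closed under nonnegative multiples, sums and pointwise limits of sequences.
Statements about Fourier multipliers with such symbols reduce to the heat kernel. -/
inductive IsGaussianMixture : (ℝ → ℝ) → Prop
  | gauss (t : ℝ) (ht : 0 < t) : IsGaussianMixture fun x => Real.exp (-t * x ^ 2)
  | const_mul {m : ℝ → ℝ} (c : ℝ) (hc : 0 ≤ c) (hm : IsGaussianMixture m) :
      IsGaussianMixture fun x => c * m x
  | add {m n : ℝ → ℝ} (hm : IsGaussianMixture m) (hn : IsGaussianMixture n) :
      IsGaussianMixture fun x => m x + n x
  | of_tendsto {m : ℕ → ℝ → ℝ} {n : ℝ → ℝ} (hm : ∀ k, IsGaussianMixture (m k))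
      (h : ∀ x, Tendsto (fun k => m k x) atTop (nhds (n x))) : IsGaussianMixture n

namespace IsGaussianMixture

variable {m n : ℝ → ℝ}

theorem measurable (hm : IsGaussianMixture m) : Measurable m := by
  induction hm with
  | gauss t _ => fun_prop
  | const_mul c _ _ ih => exact ih.const_mul c
  | add _ _ ih_m ih_n => exact ih_m.add ih_n
  | of_tendsto _ h ih => exact measurable_of_tendsto_metrizable ih (tendsto_pi_nhds.2 h)

theorem nonneg (hm : IsGaussianMixture m) (x : ℝ) : 0 ≤ m x := by
  induction hm with
  | gauss t _ => positivity
  | const_mul c hc _ ih => exact mul_nonneg hc ih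
  | add _ _ ih_m ih_n => exact add_nonneg ih_m ih_n
  | of_tendsto _ h ih => exact ge_of_tendsto' (h x) ih

theorem apply_le_of_abs_le (hm : IsGaussianMixture m) {x y : ℝ} (hxy : |x| ≤ |y|) :
    m y ≤ m x := by
  induction hm with
  | gauss t ht =>
    have := sq_le_sq.2 hxy
    exact Real.exp_le_exp.2 (by nlinarith)
  | const_mul c hc _ ih => exact mul_le_mul_of_nonneg_left ih hc
  | add _ _ ih_m ih_n => exact add_le_add ih_m ih_n
  | of_tendsto _ h ih => exact le_of_tendsto_of_tendsto' (h y) (h x) ih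

theorem apply_le_apply_zero (hm : IsGaussianMixture m) (x : ℝ) : m x ≤ m 0 :=
  hm.apply_le_of_abs_le (by simp)

theorem congr (hm : IsGaussianMixture m) (h : ∀ x, m x = n x) : IsGaussianMixture n :=
  funext h ▸ hm

theorem const {c : ℝ} (hc : 0 ≤ c) : IsGaussianMixture fun _ => c := by
  have h_one : IsGaussianMixture fun _ => (1 : ℝ) := by
    refine of_tendsto (m := fun k x => Real.exp (-(1 / ((k : ℝ) + 1)) * x ^ 2))
      (fun k => gauss _ (by positivity)) fun x => ?_
    have h : Tendsto (fun k : ℕ => -(1 / ((k : ℝ) + 1)) * x ^ 2) atTop (nhds (-0 * x ^ 2)) :=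
      (tendsto_one_div_add_atTop_nhds_zero_nat.neg).mul_const _
    simpa [Function.comp_def] using (Real.continuous_exp.tendsto _).comp h
  exact (const_mul c hc h_one).congr fun _ => mul_one c

theorem mul (hm : IsGaussianMixture m) (hn : IsGaussianMixture n) :
    IsGaussianMixture fun x => m x * n x := by
  induction hm with
  | gauss t ht =>
    induction hn with
    | gauss s hs =>
      refine (gauss (t + s) (add_pos ht hs)).congr fun x => ?_
      rw [← Real.exp_add]; ring_nf
    | const_mul c hc _ ih => exact (const_mul c hc ih).congr fun x => by ring
    | add _ _ ih_m ih_n => exact (add ih_m ih_n).congr fun x => by ring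
    | of_tendsto _ h ih => exact of_tendsto ih fun x => (h x).const_mul _
  | const_mul c hc _ ih => exact (const_mul c hc ih).congr fun x => by ring
  | add _ _ ih_m ih_n => exact (add ih_m ih_n).congr fun x => by ring
  | of_tendsto _ h ih => exact of_tendsto ih fun x => (h x).mul_const _

theorem pow (hm : IsGaussianMixture m) (k : ℕ) : IsGaussianMixture fun x => m x ^ k := by
  induction k with
  | zero => exact (const zero_le_one).congr fun _ => (pow_zero _).symm
  | succ k ih => exact (ih.mul hm).congr fun _ => (pow_succ _ _).symm

theorem sum_range {m : ℕ → ℝ → ℝ} (hm : ∀ k, IsGaussianMixture (m k)) (N : ℕ) :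
    IsGaussianMixture fun x => ∑ k ∈ Finset.range N, m k x := by
  induction N with
  | zero => exact (const le_rfl).congr fun _ => by simp
  | succ k ih => exact (ih.add (hm k)).congr fun _ => (Finset.sum_range_succ _ _).symm

theorem of_hasSum {m : ℕ → ℝ → ℝ} (hm : ∀ k, IsGaussianMixture (m k))
    (h : ∀ x, HasSum (fun k => m k x) (n x)) : IsGaussianMixture n :=
  of_tendsto (sum_range hm) fun x => (h x).tendsto_sum_nat

end IsGaussianMixture

theorem multichoose_nonneg {s : ℝ} (hs : 0 ≤ s) (k : ℕ) : 0 ≤ Ring.multichoose s k := by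
  have h_factorial := Ring.factorial_nsmul_multichoose_eq_ascPochhammer s k
  rw [Polynomial.ascPochhammer_smeval_eq_eval, nsmul_eq_mul] at h_factorial
  have h_eval : 0 ≤ (ascPochhammer ℝ k).eval s := by
    rcases hs.eq_or_lt with rfl | h
    · rw [ascPochhammer_eval_zero]; split_ifs <;> norm_num
    · exact (ascPochhammer_pos k s h).le
  rw [← h_factorial] at h_eval
  exact nonneg_of_mul_nonneg_right h_eval (by positivity)

theorem hasSum_multichoose_mul_pow (s : ℝ) {y : ℝ} (hy : |y| < 1) :
    HasSum (fun k => Ring.multichoose s k * y ^ k) ((1 - y) ^ (-s)) := by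
  have h := (Real.one_div_one_sub_rpow_hasFPowerSeriesOnBall_zero s).hasSum
    (y := y) (by simpa [enorm_eq_nnnorm, ← NNReal.coe_lt_coe] using hy)
  rw [zero_add, one_div, ← Real.rpow_neg (by linarith [le_abs_self y])] at h
  simpa [FormalMultilinearSeries.ofScalars_apply_eq, Ring.multichoose_eq, mul_comm] using h

theorem tendsto_one_div_mul_inv_one_sub_exp {y : ℝ} (hy : y ≠ 0) :
    Tendsto (fun k : ℕ => 1 / ((k : ℝ) + 1) * (1 - Real.exp (-(y * (1 / ((k : ℝ) + 1)))))⁻¹)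
      atTop (nhds y⁻¹) := by
  have h_deriv : HasDerivAt (fun u : ℝ => 1 - Real.exp (-(y * u))) y 0 := by
    have h := (((hasDerivAt_id (0 : ℝ)).const_mul y).neg.exp).const_sub 1
    simpa using h
  have h_seq : Tendsto (fun k : ℕ => 1 / ((k : ℝ) + 1)) atTop (nhdsWithin 0 {0}ᶜ) :=
    tendsto_nhdsWithin_iff.2 ⟨tendsto_one_div_add_atTop_nhds_zero_nat,
      Eventually.of_forall fun k => by
        have : (k : ℝ) + 1 ≠ 0 := by positivity
        simpa using this⟩
  refine ((h_deriv.tendsto_slope_zero.comp h_seq).inv₀ hy).congr fun k => ?_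
  simp [mul_comm]

namespace IsGaussianMixture

variable {m : ℝ → ℝ}

theorem one_sub_rpow_neg (hm : IsGaussianMixture m) (h : ∀ x, m x < 1) {s : ℝ} (hs : 0 ≤ s) :
    IsGaussianMixture fun x => (1 - m x) ^ (-s) :=
  of_hasSum (fun k => const_mul _ (multichoose_nonneg hs k) (hm.pow k)) fun x =>
    hasSum_multichoose_mul_pow s (by rw [abs_of_nonneg (hm.nonneg x)]; exact h x)

theorem inv_one_add_mul_sq {c : ℝ} (hc : 0 < c) : IsGaussianMixture fun x => (1 + c * x ^ 2)⁻¹ := by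
  refine of_tendsto (m := fun k x => 1 / ((k : ℝ) + 1) *
    (1 - Real.exp (-((1 + c * x ^ 2) * (1 / ((k : ℝ) + 1)))))⁻¹) (fun k => ?_)
    fun x => tendsto_one_div_mul_inv_one_sub_exp (by positivity)
  have h_exp : IsGaussianMixture fun x => Real.exp (-((1 + c * x ^ 2) * (1 / ((k : ℝ) + 1)))) := by
    refine (const_mul (Real.exp (-(1 / ((k : ℝ) + 1)))) (Real.exp_pos _).le
      (gauss (c / ((k : ℝ) + 1)) (by positivity))).congr fun x => ?_
    rw [← Real.exp_add]
    ring_nf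
  have h_lt (x : ℝ) : Real.exp (-((1 + c * x ^ 2) * (1 / ((k : ℝ) + 1)))) < 1 :=
    Real.exp_lt_one_iff.2 (neg_lt_zero.2 (by positivity))
  exact const_mul _ (by positivity) ((h_exp.one_sub_rpow_neg h_lt zero_le_one).congr fun _ =>
    Real.rpow_neg_one _)

end IsGaussianMixture

theorem div_tanh_pos {x : ℝ} (hx : x ≠ 0) : 0 < x / Real.tanh x := by
  have h_tanh : Real.tanh x ≠ 0 := by
    rw [Real.tanh_eq_sinh_div_cosh]
    exact div_ne_zero (Real.sinh_ne_zero.2 hx) (Real.cosh_pos x).ne'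
  rw [← inv_div]
  exact inv_pos.2 ((tanh_div_self_mem hx).1.lt_of_ne' (div_ne_zero h_tanh hx))

theorem hasSum_div_tanh {x : ℝ} (hx : x ≠ 0) :
    HasSum (fun k : ℕ => 2 * x ^ 2 / (x ^ 2 + ((k : ℝ) + 1) ^ 2 * Real.pi ^ 2))
      (x / Real.tanh x - 1) := by
  obtain ⟨z, hz_def⟩ : ∃ z : ℂ, z = x / Real.pi * Complex.I := ⟨_, rfl⟩
  have h_pi : (Real.pi : ℂ) ≠ 0 := by exact_mod_cast Real.pi_ne_zero
  have h_pi_mul : Real.pi * z = x * Complex.I := by rw [hz_def]; field_simp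
  have hz : z ∈ Complex.integerComplement := by
    rintro ⟨j, hj⟩
    have h_im := congrArg Complex.im (hj.trans hz_def)
    rw [← Complex.ofReal_div, Complex.im_ofReal_mul, Complex.I_im, Complex.intCast_im, mul_one]
      at h_im
    exact div_ne_zero hx Real.pi_ne_zero h_im.symm
  have h_sum := ((Summable.hasSum_iff_tendsto_nat (summable_cotTerm hz)).2
    (tendsto_logDeriv_euler_cot_sub hz)).mul_left z
  have h_limit : z * (Real.pi * Complex.cot (Real.pi * z) - 1 / z)
      = ((x / Real.tanh x - 1 : ℝ) : ℂ) := by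
    have h_sinh : Complex.sinh x ≠ 0 := by exact_mod_cast Real.sinh_ne_zero.2 hx
    rw [mul_sub, ← mul_assoc, mul_comm z, h_pi_mul,
      mul_one_div_cancel (Complex.integerComplement.ne_zero hz), Complex.cot, Complex.cos_mul_I,
      Complex.sin_mul_I]
    push_cast [Complex.tanh_eq_sinh_div_cosh]
    field_simp
  rw [h_limit] at h_sum
  rw [← Complex.hasSum_ofReal]
  refine h_sum.congr_fun fun k => ?_
  have h_add := Complex.integerComplement_add_ne_zero hz ((k : ℤ) + 1)
  have h_sub := Complex.integerComplement_add_ne_zero hz (-((k : ℤ) + 1))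
  push_cast at h_add h_sub
  rw [← sub_eq_add_neg] at h_sub
  have hx_sq : (x : ℂ) ^ 2 = -(z ^ 2 * Real.pi ^ 2) := by
    rw [← mul_pow, mul_comm z, h_pi_mul, mul_pow, Complex.I_sq]; ring
  have h_factor : -(z ^ 2 * (Real.pi : ℂ) ^ 2) + ((k : ℂ) + 1) ^ 2 * (Real.pi : ℂ) ^ 2
      = -((z + (k + 1)) * (z - (k + 1)) * (Real.pi : ℂ) ^ 2) := by ring
  rw [cotTerm_identity hz]
  push_cast
  rw [hx_sq, h_factor]
  field_simp

theorem tendsto_whithamSymbol {s : ℝ} (x : ℝ) :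
    Tendsto (fun N : ℕ => (1 + ∑ k ∈ Finset.range N,
      2 * x ^ 2 / (x ^ 2 + ((k : ℝ) + 1) ^ 2 * Real.pi ^ 2)) ^ (-s))
      atTop (nhds (whithamSymbol s x)) := by
  unfold whithamSymbol
  split_ifs with hx
  · simp [hx]
  · have h_limit : (Real.tanh x / x) ^ s = (1 + (x / Real.tanh x - 1)) ^ (-s) := by
      rw [add_sub_cancel, Real.rpow_neg (div_tanh_pos hx).le, ← Real.inv_rpow (div_tanh_pos hx).le,
        inv_div]
    rw [h_limit]
    refine ((hasSum_div_tanh hx).tendsto_sum_nat.const_add 1).rpow_const (Or.inl ?_)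
    rw [add_sub_cancel]
    exact (div_tanh_pos hx).ne'

/-- With `v k = (1 + x² / ((k + 1)² π²))⁻¹`, the `N`-th Mittag-Leffler sum of `x coth x` is
`2 N + 1 - 2 ∑ v k`: a constant minus a Gaussian mixture bounded by that constant. -/
theorem isGaussianMixture_mittagLeffler_rpow_neg {s : ℝ} (hs : 0 ≤ s) (N : ℕ) :
    IsGaussianMixture fun x => (1 + ∑ k ∈ Finset.range N,
      2 * x ^ 2 / (x ^ 2 + ((k : ℝ) + 1) ^ 2 * Real.pi ^ 2)) ^ (-s) := by
  let v : ℕ → ℝ → ℝ := fun k x => (1 + 1 / (((k : ℝ) + 1) ^ 2 * Real.pi ^ 2) * x ^ 2)⁻¹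
  have h_mix : IsGaussianMixture fun x => 2 / (2 * (N : ℝ) + 1) * ∑ k ∈ Finset.range N, v k x :=
    .const_mul _ (by positivity) (.sum_range (fun k => .inv_one_add_mul_sq (by positivity)) N)
  have hv_le (k : ℕ) (x : ℝ) : v k x ≤ 1 :=
    inv_le_one_of_one_le₀ (le_add_of_nonneg_right (by positivity))
  have h_lt (x : ℝ) : 2 / (2 * (N : ℝ) + 1) * ∑ k ∈ Finset.range N, v k x < 1 := by
    have h_sum : ∑ k ∈ Finset.range N, v k x ≤ N := by
      simpa using Finset.sum_le_sum fun k (_ : k ∈ Finset.range N) => hv_le k x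
    rw [div_mul_eq_mul_div, div_lt_one (by positivity)]
    linarith
  refine (IsGaussianMixture.const_mul ((2 * (N : ℝ) + 1) ^ (-s)) (by positivity)
    (h_mix.one_sub_rpow_neg h_lt hs)).congr fun x => ?_
  rw [← Real.mul_rpow (by positivity) (sub_nonneg.2 (h_lt x).le)]
  congr 1
  have h_term (k : ℕ) :
      2 * x ^ 2 / (x ^ 2 + ((k : ℝ) + 1) ^ 2 * Real.pi ^ 2) = 2 * (1 - v k x) := by
    have := Real.pi_pos
    have : 0 < x ^ 2 + ((k : ℝ) + 1) ^ 2 * Real.pi ^ 2 := by positivity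
    simp only [v]
    field_simp
    ring
  simp only [h_term, ← Finset.mul_sum, Finset.sum_sub_distrib, Finset.sum_const, Finset.card_range,
    nsmul_eq_mul, mul_one]
  field_simp
  ring

theorem isGaussianMixture_whithamSymbol {s : ℝ} (hs : 0 ≤ s) :
    IsGaussianMixture (whithamSymbol s) :=
  .of_tendsto (isGaussianMixture_mittagLeffler_rpow_neg hs) tendsto_whithamSymbol

section Plancherel

theorem norm_toLp_two_sq {X E : Type*} [MeasurableSpace X] {μ : Measure X}
    [NormedAddCommGroup E] {f : X → E} (hf : MemLp f 2 μ) :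
    ‖hf.toLp‖ ^ 2 = ∫ x, ‖f x‖ ^ 2 ∂μ := by
  have h_nonneg : 0 ≤ ∫ x, ‖f x‖ ^ 2 ∂μ := integral_nonneg fun x => by positivity
  rw [Lp.norm_toLp, hf.eLpNorm_eq_integral_rpow_norm (by norm_num) (by norm_num)]
  simp only [ENNReal.toReal_ofNat, Real.rpow_ofNat]
  rw [ENNReal.toReal_ofReal (Real.rpow_nonneg h_nonneg _), ← Real.rpow_natCast,
    ← Real.rpow_mul h_nonneg]
  norm_num

variable {V H : Type*} [NormedAddCommGroup V] [InnerProductSpace ℝ V] [FiniteDimensional ℝ V]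
  [MeasurableSpace V] [BorelSpace V]
  [NormedAddCommGroup H] [InnerProductSpace ℂ H] [CompleteSpace H]

theorem coeFn_fourier_toLp {f : V → H} (hf₁ : Integrable f) (hf₂ : MemLp f 2) :
    ((𝓕 hf₂.toLp : Lp H 2 (volume : Measure V)) : V → H) =ᵐ[volume] 𝓕 f := by
  have h_cont : Continuous (𝓕 f) :=
    VectorFourier.fourierIntegral_continuous Real.continuous_fourierChar
      (innerSL ℝ).continuous₂ hf₁
  refine ae_eq_of_integral_contDiff_smul_eq
    ((Lp.memLp (𝓕 hf₂.toLp : Lp H 2 (volume : Measure V))).locallyIntegrable (by norm_num))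
    h_cont.locallyIntegrable fun g hg hg_supp => ?_
  have hg_supp' : HasCompactSupport fun x => (g x : ℂ) := hg_supp.comp_left Complex.ofReal_zero
  let G : SchwartzMap V ℂ := hg_supp'.toSchwartzMap (Complex.ofRealCLM.contDiff.comp hg)
  have h_distribution := congrArg (fun T => T G) (Lp.fourier_toTemperedDistribution_eq hf₂.toLp)
  simp only [TemperedDistribution.fourier_apply, Lp.toTemperedDistribution_apply]
    at h_distribution
  have h_flip : ∫ w, 𝓕 (G : V → ℂ) w • f w = ∫ x, G x • 𝓕 f x := by
    have h := VectorFourier.integral_fourierIntegral_smul_eq_flip (μ := volume) (ν := volume)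
      (L := innerₗ V) Real.continuous_fourierChar continuous_inner G.integrable hf₁
    rw [flip_innerₗ] at h
    exact h
  calc ∫ x, g x • (𝓕 hf₂.toLp : Lp H 2 (volume : Measure V)) x
      = ∫ x, G x • (𝓕 hf₂.toLp : Lp H 2 (volume : Measure V)) x := rfl
    _ = ∫ x, (𝓕 G) x • (hf₂.toLp : V → H) x := h_distribution.symm
    _ = ∫ x, 𝓕 (G : V → ℂ) x • f x := by
        refine integral_congr_ae ?_
        filter_upwards [hf₂.coeFn_toLp] with x hx
        rw [hx, SchwartzMap.fourier_coe]
    _ = ∫ x, g x • 𝓕 f x := h_flip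

theorem memLp_two_fourier {f : V → H} (hf₁ : Integrable f) (hf₂ : MemLp f 2) :
    MemLp (𝓕 f) 2 :=
  (memLp_congr_ae (coeFn_fourier_toLp hf₁ hf₂)).1 (Lp.memLp _)

theorem integral_norm_fourier_sq {f : V → H} (hf₁ : Integrable f) (hf₂ : MemLp f 2) :
    ∫ w, ‖𝓕 f w‖ ^ 2 = ∫ x, ‖f x‖ ^ 2 := by
  rw [← norm_toLp_two_sq hf₂, ← Lp.norm_fourier_eq, ← norm_toLp_two_sq (memLp_two_fourier hf₁ hf₂)]
  congr 2
  exact (Lp.ext ((MemLp.coeFn_toLp _).trans (coeFn_fourier_toLp hf₁ hf₂).symm))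

end Plancherel

/-- The quadratic form `⟨m(D) f, f⟩` of the Fourier multiplier with symbol `m`. As in
`whithamConv`, the frequency of `m` is `2π` times the variable of `𝓕`. -/
noncomputable def symbolEnergy (m : ℝ → ℝ) (f : ℝ → ℝ) : ℝ :=
  ∫ w, m (2 * Real.pi * w) * ‖𝓕 (fun x => (f x : ℂ)) w‖ ^ 2

theorem fourier_comp_div {u : ℝ} (hu : 0 < u) (f : ℝ → ℂ) (w : ℝ) :
    𝓕 (fun x => f (x / u)) w = u * 𝓕 f (u * w) := by
  have h := Measure.integral_comp_div (fun x : ℝ => Real.fourierChar (-(x * (u * w))) • f x) u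
  rw [abs_of_pos hu, Complex.real_smul] at h
  rw [Real.fourier_real_eq, Real.fourier_real_eq, ← h]
  refine integral_congr_ae (Eventually.of_forall fun x => ?_)
  dsimp only
  congr 3
  field_simp

theorem symbolEnergy_comp_div {u : ℝ} (hu : 0 < u) (m f : ℝ → ℝ) :
    symbolEnergy m (fun x => f (x / u)) = u * symbolEnergy (fun x => m (x / u)) f := by
  have h := Measure.integral_comp_mul_left (fun w : ℝ => u ^ 2 *
    (m (2 * Real.pi * w / u) * ‖𝓕 (fun x => (f x : ℂ)) w‖ ^ 2)) u
  rw [abs_of_pos (inv_pos.2 hu), smul_eq_mul] at h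
  calc symbolEnergy m (fun x => f (x / u))
      = ∫ w, u ^ 2 *
          (m (2 * Real.pi * (u * w) / u) * ‖𝓕 (fun x => (f x : ℂ)) (u * w)‖ ^ 2) := by
        refine integral_congr_ae (Eventually.of_forall fun w => ?_)
        dsimp only
        rw [fourier_comp_div hu (fun x => (f x : ℂ)), norm_mul, mul_pow, Complex.norm_real,
          Real.norm_eq_abs, sq_abs, mul_left_comm (2 * Real.pi), mul_div_cancel_left₀ _ hu.ne',
          mul_left_comm]
    _ = u * symbolEnergy (fun x => m (x / u)) f := by
        rw [h, integral_const_mul, symbolEnergy, ← mul_assoc, sq, inv_mul_cancel_left₀ hu.ne']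

theorem symbolEnergy_const_mul (m f : ℝ → ℝ) (c : ℝ) :
    symbolEnergy m (fun x => c * f x) = c ^ 2 * symbolEnergy m f := by
  have h_fourier (w : ℝ) :
      𝓕 (fun x => ((c * f x : ℝ) : ℂ)) w = c * 𝓕 (fun x => (f x : ℂ)) w := by
    simp only [Real.fourier_real_eq, ← integral_const_mul, Circle.smul_def, smul_eq_mul,
      Complex.ofReal_mul, mul_left_comm]
  simp only [symbolEnergy, ← integral_const_mul, h_fourier, norm_mul, mul_pow, Complex.norm_real,
    Real.norm_eq_abs, sq_abs, mul_left_comm]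

theorem symbolEnergy_const_mul_symbol (c : ℝ) (m f : ℝ → ℝ) :
    symbolEnergy (fun x => c * m x) f = c * symbolEnergy m f := by
  simp only [symbolEnergy, mul_assoc, integral_const_mul]

section SymbolEnergy

variable {f : ℝ → ℝ} (hf₁ : Integrable f) (hf₂ : MemLp f 2)
include hf₁ hf₂

theorem integrable_norm_fourier_sq : Integrable fun w => ‖𝓕 (fun x => (f x : ℂ)) w‖ ^ 2 :=
  (memLp_two_fourier hf₁.ofReal hf₂.ofReal).integrable_norm_pow (by norm_num)

theorem symbolEnergy_const (c : ℝ) : symbolEnergy (fun _ => c) f = c * ∫ x, f x ^ 2 := by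
  have h : ∫ w, ‖𝓕 (fun x => (f x : ℂ)) w‖ ^ 2 = ∫ x, ‖(f x : ℂ)‖ ^ 2 :=
    integral_norm_fourier_sq hf₁.ofReal hf₂.ofReal
  simp only [symbolEnergy, integral_const_mul, h, Complex.norm_real, Real.norm_eq_abs, sq_abs]

theorem integrable_symbol_mul_norm_fourier_sq {m : ℝ → ℝ} (hm : Measurable m) {C : ℝ}
    (hC : ∀ x, |m x| ≤ C) :
    Integrable fun w => m (2 * Real.pi * w) * ‖𝓕 (fun x => (f x : ℂ)) w‖ ^ 2 :=
  (integrable_norm_fourier_sq hf₁ hf₂).bdd_mul (hm.comp (by fun_prop)).aestronglyMeasurable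
    (Eventually.of_forall fun _ => hC _)

theorem symbolEnergy_mono {m n : ℝ → ℝ} (hm : Measurable m) (hn : Measurable n) {C : ℝ}
    (hCm : ∀ x, |m x| ≤ C) (hCn : ∀ x, |n x| ≤ C) (hmn : ∀ x, m x ≤ n x) :
    symbolEnergy m f ≤ symbolEnergy n f :=
  integral_mono (integrable_symbol_mul_norm_fourier_sq hf₁ hf₂ hm hCm)
    (integrable_symbol_mul_norm_fourier_sq hf₁ hf₂ hn hCn)
    fun _ => mul_le_mul_of_nonneg_right (hmn _) (by positivity)

theorem tendsto_symbolEnergy {m : ℕ → ℝ → ℝ} {n : ℝ → ℝ} (hm : ∀ k, Measurable (m k)) {C : ℝ}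
    (hC : ∀ k x, |m k x| ≤ C) (h : ∀ x, Tendsto (fun k => m k x) atTop (nhds (n x))) :
    Tendsto (fun k => symbolEnergy (m k) f) atTop (nhds (symbolEnergy n f)) := by
  refine tendsto_integral_of_dominated_convergence
    (fun w => C * ‖𝓕 (fun x => (f x : ℂ)) w‖ ^ 2)
    (fun k => (integrable_symbol_mul_norm_fourier_sq hf₁ hf₂ (hm k) (hC k)).aestronglyMeasurable)
    ((integrable_norm_fourier_sq hf₁ hf₂).const_mul C)
    (fun k => Eventually.of_forall fun w => ?_)
    (Eventually.of_forall fun w => (h _).mul_const _)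
  rw [Real.norm_eq_abs, abs_mul, abs_of_nonneg (sq_nonneg ‖_‖)]
  exact mul_le_mul_of_nonneg_right (hC k _) (by positivity)

theorem dispersiveEnergy_sq :
    dispersiveEnergy f ^ 2 = symbolEnergy (fun x => whithamSymbol (1 / 4) x ^ 2) f := by
  have hf_complex : MemLp (fun x => (f x : ℂ)) 2 (volume : Measure ℝ) := hf₂.ofReal
  rw [dispersiveEnergy, dif_pos hf_complex, whithamConv, ← Lp.norm_fourier_eq,
    FourierTransform.fourier_fourierInv_eq, norm_toLp_two_sq]
  refine integral_congr_ae ?_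
  filter_upwards [coeFn_fourier_toLp hf₁.ofReal hf_complex] with w hw
  have hw' : (𝓕 hf_complex.toLp : Lp ℂ 2 (volume : Measure ℝ)) w = 𝓕 (fun x => (f x : ℂ)) w := hw
  rw [hw', norm_mul, mul_pow, Complex.norm_real, Real.norm_eq_abs, sq_abs]

end SymbolEnergy

theorem dispersiveEnergy_nonneg (f : ℝ → ℝ) : 0 ≤ dispersiveEnergy f := by
  unfold dispersiveEnergy
  split_ifs
  · exact norm_nonneg _
  · exact le_rfl

namespace IsGaussianMixture

variable {m f g : ℝ → ℝ}

theorem abs_apply_le (hm : IsGaussianMixture m) (x : ℝ) : |m x| ≤ m 0 := by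
  rw [abs_of_nonneg (hm.nonneg x)]
  exact hm.apply_le_apply_zero x

theorem symbolEnergy_le (hm : IsGaussianMixture m) (hf₁ : Integrable f) (hf₂ : MemLp f 2) :
    symbolEnergy m f ≤ m 0 * ∫ x, f x ^ 2 := by
  rw [← symbolEnergy_const hf₁ hf₂]
  exact symbolEnergy_mono hf₁ hf₂ hm.measurable measurable_const hm.abs_apply_le
    (fun _ => (abs_of_nonneg (hm.nonneg 0)).le) hm.apply_le_apply_zero

theorem symbolEnergy_add_symbol {n : ℝ → ℝ} (hm : IsGaussianMixture m) (hn : IsGaussianMixture n)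
    (hf₁ : Integrable f) (hf₂ : MemLp f 2) :
    symbolEnergy (fun x => m x + n x) f = symbolEnergy m f + symbolEnergy n f := by
  simp only [symbolEnergy, add_mul]
  exact integral_add
    (integrable_symbol_mul_norm_fourier_sq hf₁ hf₂ hm.measurable hm.abs_apply_le)
    (integrable_symbol_mul_norm_fourier_sq hf₁ hf₂ hn.measurable hn.abs_apply_le)

theorem symbolEnergy_sub_le_of_gauss (hm : IsGaussianMixture m) (hf₁ : Integrable f)
    (hf₂ : MemLp f 2) (hg₁ : Integrable g) (hg₂ : MemLp g 2) {κ : ℝ}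
    (h : ∀ t : ℝ, 0 < t → symbolEnergy (fun x => Real.exp (-t * x ^ 2)) f
      - symbolEnergy (fun x => Real.exp (-t * x ^ 2)) g ≤ κ) :
    symbolEnergy m f - symbolEnergy m g ≤ κ * m 0 := by
  induction hm with
  | gauss t ht => simpa using h t ht
  | const_mul c hc _ ih =>
    rw [symbolEnergy_const_mul_symbol, symbolEnergy_const_mul_symbol]
    nlinarith
  | add hm hn ih_m ih_n =>
    rw [hm.symbolEnergy_add_symbol hn hf₁ hf₂, hm.symbolEnergy_add_symbol hn hg₁ hg₂]
    linarith
  | of_tendsto hm h_lim ih =>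
    obtain ⟨C, hC⟩ := (h_lim 0).bddAbove_range
    have h_bound k x := ((hm k).abs_apply_le x).trans (hC ⟨k, rfl⟩)
    exact le_of_tendsto_of_tendsto'
      ((tendsto_symbolEnergy hf₁ hf₂ (fun k => (hm k).measurable) h_bound h_lim).sub
        (tendsto_symbolEnergy hg₁ hg₂ (fun k => (hm k).measurable) h_bound h_lim))
      ((h_lim 0).const_mul κ) ih

theorem mul_symbolEnergy_le_comp_div (hm : IsGaussianMixture m) {u : ℝ} (hu : 1 ≤ u)
    (hf₁ : Integrable f) (hf₂ : MemLp f 2) :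
    u * symbolEnergy m f ≤ symbolEnergy m (fun x => f (x / u)) := by
  have hu_pos : 0 < u := by linarith
  rw [symbolEnergy_comp_div hu_pos]
  refine mul_le_mul_of_nonneg_left (symbolEnergy_mono hf₁ hf₂ hm.measurable
    (hm.measurable.comp (by fun_prop)) hm.abs_apply_le (fun x => hm.abs_apply_le (x / u))
    fun x => hm.apply_le_of_abs_le ?_) hu_pos.le
  rw [abs_div, abs_of_pos hu_pos]
  exact div_le_self (abs_nonneg _) hu

theorem tendsto_symbolEnergy_comp_div (hm : IsGaussianMixture m) (hm_cont : ContinuousAt m 0)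
    (hf₁ : Integrable f) (hf₂ : MemLp f 2) {u : ℕ → ℝ} (hu : Tendsto u atTop atTop) :
    Tendsto (fun k => symbolEnergy (fun x => m (x / u k)) f) atTop
      (nhds (m 0 * ∫ x, f x ^ 2)) := by
  rw [← symbolEnergy_const hf₁ hf₂]
  exact tendsto_symbolEnergy hf₁ hf₂ (fun k => hm.measurable.comp (by fun_prop))
    (fun k x => hm.abs_apply_le (x / u k)) fun x => hm_cont.tendsto.comp (hu.const_div_atTop x)

end IsGaussianMixture

/-- Even, radially nonincreasing probability densities on the line. -/
structure IsBumpKernel (k : ℝ → ℝ) : Prop where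
  nonneg : ∀ x, 0 ≤ k x
  measurable : Measurable k
  integrable : Integrable k
  integral_eq_one : ∫ x, k x = 1
  apply_le_of_abs_le : ∀ {x y}, |x| ≤ |y| → k y ≤ k x

/-- The quadratic form `⟨k ∗ f, f⟩` of the convolution with `k`. -/
noncomputable def kernelEnergy (k f : ℝ → ℝ) : ℝ :=
  ∫ p : ℝ × ℝ, k (p.1 - p.2) * (f p.1 * f p.2)

namespace IsBumpKernel

variable {k f g : ℝ → ℝ}

theorem apply_sub_comm (hk : IsBumpKernel k) (x y : ℝ) : k (x - y) = k (y - x) :=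
  le_antisymm (hk.apply_le_of_abs_le (abs_sub_comm y x).le)
    (hk.apply_le_of_abs_le (abs_sub_comm x y).le)

theorem integrable_mul_snd (hk : IsBumpKernel k) (hf : Integrable f) :
    Integrable fun p : ℝ × ℝ => k (p.1 - p.2) * f p.2 := by
  simpa only [ContinuousLinearMap.mul_apply', mul_comm, Measure.volume_eq_prod] using
    Integrable.convolution_integrand (μ := volume) (ν := volume) (ContinuousLinearMap.mul ℝ ℝ) hf
      hk.integrable

theorem integrable_mul_fst (hk : IsBumpKernel k) (hf : Integrable f) :
    Integrable fun p : ℝ × ℝ => k (p.1 - p.2) * f p.1 := by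
  refine (hk.integrable_mul_snd hf).swap.congr (Eventually.of_forall fun p => ?_)
  simp only [Function.comp_apply, Prod.fst_swap, Prod.snd_swap]
  rw [hk.apply_sub_comm]

theorem integral_mul_fst (hk : IsBumpKernel k) (hf : Integrable f) :
    ∫ p : ℝ × ℝ, k (p.1 - p.2) * f p.1 = ∫ x, f x := by
  rw [Measure.volume_eq_prod, integral_prod _ (hk.integrable_mul_fst hf)]
  simp only [integral_mul_const, integral_sub_left_eq_self k volume, hk.integral_eq_one, one_mul]

theorem integral_mul_snd (hk : IsBumpKernel k) (hf : Integrable f) :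
    ∫ p : ℝ × ℝ, k (p.1 - p.2) * f p.2 = ∫ x, f x := by
  rw [← hk.integral_mul_fst hf, Measure.volume_eq_prod,
    ← integral_prod_swap (fun p : ℝ × ℝ => k (p.1 - p.2) * f p.1)]
  refine integral_congr_ae (Eventually.of_forall fun p => ?_)
  simp only [Prod.fst_swap, Prod.snd_swap]
  rw [hk.apply_sub_comm]

theorem measurable_sub (hk : IsBumpKernel k) : Measurable fun p : ℝ × ℝ => k (p.1 - p.2) :=
  hk.measurable.comp (measurable_fst.sub measurable_snd)

theorem integrable_energy (hk : IsBumpKernel k) (hf : MemLp f 2) :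
    Integrable fun p : ℝ × ℝ => k (p.1 - p.2) * (f p.1 * f p.2) := by
  refine ((hk.integrable_mul_fst hf.integrable_sq).add
    (hk.integrable_mul_snd hf.integrable_sq)).mono'
    (hk.measurable_sub.aestronglyMeasurable.mul (hf.1.comp_fst.mul hf.1.comp_snd))
    (Eventually.of_forall fun p => ?_)
  rw [Real.norm_eq_abs, abs_mul, abs_of_nonneg (hk.nonneg _), Pi.add_apply, ← mul_add]
  refine mul_le_mul_of_nonneg_left ?_ (hk.nonneg _)
  rw [abs_le]
  constructor <;> nlinarith [sq_nonneg (f p.1 + f p.2), sq_nonneg (f p.1 - f p.2)]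

theorem dirichlet_eq (k f : ℝ → ℝ) (p : ℝ × ℝ) : k (p.1 - p.2) * (f p.1 - f p.2) ^ 2
    = k (p.1 - p.2) * f p.1 ^ 2 + k (p.1 - p.2) * f p.2 ^ 2
      - 2 * (k (p.1 - p.2) * (f p.1 * f p.2)) := by ring

theorem integrable_dirichlet (hk : IsBumpKernel k) (hf : MemLp f 2) :
    Integrable fun p : ℝ × ℝ => k (p.1 - p.2) * (f p.1 - f p.2) ^ 2 := by
  simp only [dirichlet_eq]
  exact ((hk.integrable_mul_fst hf.integrable_sq).add (hk.integrable_mul_snd hf.integrable_sq)).sub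
    ((hk.integrable_energy hf).const_mul 2)

theorem integral_dirichlet (hk : IsBumpKernel k) (hf : MemLp f 2) :
    ∫ p : ℝ × ℝ, k (p.1 - p.2) * (f p.1 - f p.2) ^ 2
      = 2 * ((∫ x, f x ^ 2) - kernelEnergy k f) := by
  have h_fst := hk.integrable_mul_fst hf.integrable_sq
  have h_snd := hk.integrable_mul_snd hf.integrable_sq
  simp only [dirichlet_eq]
  rw [integral_sub (h_fst.fun_add h_snd) ((hk.integrable_energy hf).const_mul 2),
    integral_add h_fst h_snd, hk.integral_mul_fst hf.integrable_sq,
    hk.integral_mul_snd hf.integrable_sq, integral_const_mul, kernelEnergy]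
  ring

theorem kernelEnergy_le (hk : IsBumpKernel k) (hf : MemLp f 2) :
    kernelEnergy k f ≤ ∫ x, f x ^ 2 := by
  have h_nonneg : 0 ≤ ∫ p : ℝ × ℝ, k (p.1 - p.2) * (f p.1 - f p.2) ^ 2 :=
    integral_nonneg fun p => mul_nonneg (hk.nonneg _) (sq_nonneg _)
  rw [hk.integral_dirichlet hf] at h_nonneg
  linarith

theorem kernelEnergy_nonneg (hk : IsBumpKernel k) (hf : ∀ x, 0 ≤ f x) : 0 ≤ kernelEnergy k f :=
  integral_nonneg fun _ => mul_nonneg (hk.nonneg _) (mul_nonneg (hf _) (hf _))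

theorem kernelEnergy_sub_le_of_contraction (hk : IsBumpKernel k) (hf : MemLp f 2)
    (hg : MemLp g 2) (h : ∀ x y, |g x - g y| ≤ |f x - f y|) :
    kernelEnergy k f - kernelEnergy k g ≤ (∫ x, f x ^ 2) - ∫ x, g x ^ 2 := by
  have h_dirichlet := integral_mono (hk.integrable_dirichlet hg) (hk.integrable_dirichlet hf)
    fun p => mul_le_mul_of_nonneg_left (sq_le_sq.2 (h p.1 p.2)) (hk.nonneg _)
  rw [hk.integral_dirichlet hg, hk.integral_dirichlet hf] at h_dirichlet
  linarith

theorem lintegral_dirichlet (hk : IsBumpKernel k) (hf : MemLp f 2) :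
    ∫⁻ x, ∫⁻ y, ENNReal.ofReal (k (x - y) * (f x - f y) ^ 2)
      = ENNReal.ofReal (2 * ((∫ x, f x ^ 2) - kernelEnergy k f)) := by
  have h_int := hk.integrable_dirichlet hf
  rw [← hk.integral_dirichlet hf, ofReal_integral_eq_lintegral_ofReal h_int
    (Eventually.of_forall fun p => mul_nonneg (hk.nonneg _) (sq_nonneg _)),
    Measure.volume_eq_prod, lintegral_prod _ h_int.1.aemeasurable.ennreal_ofReal]

theorem lintegral_energy (hk : IsBumpKernel k) (hf : MemLp f 2) (hf_nonneg : ∀ x, 0 ≤ f x) :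
    ∫⁻ x, ∫⁻ y, ENNReal.ofReal (k (x - y) * (f x * f y))
      = ENNReal.ofReal (kernelEnergy k f) := by
  have h_int := hk.integrable_energy hf
  rw [kernelEnergy, ofReal_integral_eq_lintegral_ofReal h_int
    (Eventually.of_forall fun p => mul_nonneg (hk.nonneg _)
      (mul_nonneg (hf_nonneg _) (hf_nonneg _))),
    Measure.volume_eq_prod, lintegral_prod _ h_int.1.aemeasurable.ennreal_ofReal]

end IsBumpKernel

/-- The heat kernel at time `t`, whose Fourier symbol is `exp (-t ξ²)`. -/
noncomputable def gaussKernel (t x : ℝ) : ℝ :=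
  (Real.sqrt (4 * Real.pi * t))⁻¹ * Real.exp (-(1 / (4 * t)) * x ^ 2)

theorem isBumpKernel_gaussKernel {t : ℝ} (ht : 0 < t) : IsBumpKernel (gaussKernel t) where
  nonneg x := by unfold gaussKernel; positivity
  measurable := by unfold gaussKernel; fun_prop
  integrable := (integrable_exp_neg_mul_sq (by positivity)).const_mul _
  integral_eq_one := by
    unfold gaussKernel
    rw [integral_const_mul, integral_gaussian, inv_mul_eq_one₀ (by positivity)]
    congr 1
    field_simp
  apply_le_of_abs_le {x y} h := by
    unfold gaussKernel
    gcongr _ * Real.exp ?_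
    exact mul_le_mul_of_nonpos_left (sq_le_sq.2 h) (neg_nonpos.2 (by positivity))

theorem fourier_gauss_symbol {t : ℝ} (ht : 0 < t) (x : ℝ) :
    𝓕 (fun w : ℝ => (Real.exp (-t * (2 * Real.pi * w) ^ 2) : ℂ)) x = gaussKernel t x := by
  have hb : 0 < ((4 * Real.pi * t : ℝ) : ℂ).re := by
    rw [Complex.ofReal_re]
    positivity
  have h_symbol : (fun w : ℝ => (Real.exp (-t * (2 * Real.pi * w) ^ 2) : ℂ))
      = fun w : ℝ => Complex.exp (-Real.pi * ((4 * Real.pi * t : ℝ) : ℂ) * w ^ 2) := by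
    ext w
    push_cast
    ring_nf
  rw [h_symbol, congrFun (fourier_gaussian_pi hb) x, gaussKernel, Real.sqrt_eq_rpow]
  push_cast
  rw [Complex.ofReal_cpow (by positivity)]
  push_cast
  rw [one_div]
  congr 2
  have : (t : ℂ) ≠ 0 := by exact_mod_cast ht.ne'
  have : (Real.pi : ℂ) ≠ 0 := by exact_mod_cast Real.pi_ne_zero
  field_simp

theorem integral_mul_norm_fourier_sq {γ f : ℝ → ℂ} (hγ : Integrable γ) (hf : Integrable f) :
    ∫ w, γ w * ((‖𝓕 f w‖ ^ 2 : ℝ) : ℂ)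
      = ∫ p : ℝ × ℝ, 𝓕 γ (p.1 - p.2) * (f p.1 * starRingEnd ℂ (f p.2)) := by
  -- Fubini for the pairing `((x, y), w) ↦ (x - y) w`, for which the Fourier integral of
  -- `f ⊗ conj f` is `‖𝓕 f‖ ^ 2`.
  let L : ℝ × ℝ →ₗ[ℝ] ℝ →ₗ[ℝ] ℝ :=
    (LinearMap.mul ℝ ℝ).comp (LinearMap.fst ℝ ℝ ℝ - LinearMap.snd ℝ ℝ ℝ)
  have hL : Continuous fun p : (ℝ × ℝ) × ℝ => L p.1 p.2 := by
    change Continuous fun p : (ℝ × ℝ) × ℝ => (p.1.1 - p.1.2) * p.2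
    fun_prop
  have h_prod : Integrable (fun p : ℝ × ℝ => f p.1 * starRingEnd ℂ (f p.2)) :=
    hf.mul_prod (Complex.conjCLE.integrable_comp_iff.2 hf)
  have h_flip := VectorFourier.integral_fourierIntegral_smul_eq_flip (μ := volume) (ν := volume)
    Real.continuous_fourierChar hL h_prod hγ
  have h_left (w : ℝ) : VectorFourier.fourierIntegral Real.fourierChar volume L
      (fun p : ℝ × ℝ => f p.1 * starRingEnd ℂ (f p.2)) w = ((‖𝓕 f w‖ ^ 2 : ℝ) : ℂ) := by
    rw [Complex.ofReal_pow, ← Complex.mul_conj', Real.fourier_real_eq, ← integral_conj,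
      ← integral_prod_mul, VectorFourier.fourierIntegral, Measure.volume_eq_prod]
    refine integral_congr_ae (Eventually.of_forall fun p => ?_)
    have h_char : Real.fourierChar (-L p w)
        = Real.fourierChar (-(p.1 * w)) * (Real.fourierChar (-(p.2 * w)))⁻¹ := by
      rw [← AddChar.map_neg_eq_inv, ← AddChar.map_add_eq_mul]
      exact congrArg Real.fourierChar (by simp [L]; ring)
    simp only [h_char, Circle.smul_def, smul_eq_mul, map_mul, Circle.coe_mul,
      Circle.coe_inv_eq_conj]
    ring
  have h_right (p : ℝ × ℝ) : VectorFourier.fourierIntegral Real.fourierChar volume L.flip γ p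
      = 𝓕 γ (p.1 - p.2) := by
    rw [Real.fourier_real_eq]
    refine integral_congr_ae (Eventually.of_forall fun w => ?_)
    dsimp only
    rw [mul_comm w]
    rfl
  simpa only [h_left, h_right, smul_eq_mul, mul_comm (γ _), mul_comm (𝓕 γ _)] using h_flip

theorem symbolEnergy_gauss {t : ℝ} (ht : 0 < t) {f : ℝ → ℝ} (hf : Integrable f) :
    symbolEnergy (fun x => Real.exp (-t * x ^ 2)) f = kernelEnergy (gaussKernel t) f := by
  have h_int : Integrable fun w : ℝ => Real.exp (-t * (2 * Real.pi * w) ^ 2) := by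
    have h := integrable_exp_neg_mul_sq (b := t * (2 * Real.pi) ^ 2) (by positivity)
    simpa only [mul_pow, neg_mul, mul_assoc] using h
  have h := integral_mul_norm_fourier_sq (γ := fun w => (Real.exp (-t * (2 * Real.pi * w) ^ 2) : ℂ))
    (f := fun x => (f x : ℂ)) h_int.ofReal hf.ofReal
  apply Complex.ofReal_injective
  rw [symbolEnergy, kernelEnergy, ← integral_complex_ofReal, ← integral_complex_ofReal]
  simpa only [fourier_gauss_symbol ht, Complex.conj_ofReal, Complex.ofReal_mul] using h

/-- `ψ` is the change of variable on the line, fixing `0`, that transports Lebesgue measure to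
`p dx`, i.e. the inverse of a primitive of `p`. -/
structure IsReparam (p ψ : ℝ → ℝ) : Prop where
  measurable_density : Measurable p
  density_pos : ∀ x, 0 < p x
  locallyIntegrable : LocallyIntegrable p
  measurable : Measurable ψ
  map_eq : Measure.map ψ volume = volume.withDensity fun x => ENNReal.ofReal (p x)
  abs_sub_eq : ∀ t s, |t - s| = |∫ x in ψ s..ψ t, p x|
  map_zero : ψ 0 = 0

section Primitive

variable {p : ℝ → ℝ} {c : ℝ}

theorem intervalIntegrable_of_locallyIntegrable (hp : LocallyIntegrable p) (a b : ℝ) :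
    IntervalIntegrable p volume a b :=
  (hp.integrableOn_isCompact isCompact_uIcc).intervalIntegrable

theorem mul_sub_le_intervalIntegral (hp : LocallyIntegrable p) (hc : ∀ x, c ≤ p x) {a b : ℝ}
    (hab : a ≤ b) : c * (b - a) ≤ ∫ x in a..b, p x := by
  simpa only [intervalIntegral.integral_const, smul_eq_mul, mul_comm] using
    intervalIntegral.integral_mono_on hab (intervalIntegrable_const (c := c))
      (intervalIntegrable_of_locallyIntegrable hp a b) fun x _ => hc x

theorem strictMono_primitive (hp : LocallyIntegrable p) (hc_pos : 0 < c) (hc : ∀ x, c ≤ p x) :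
    StrictMono fun x => ∫ s in (0 : ℝ)..x, p s := fun x y hxy => by
  have h_int := intervalIntegrable_of_locallyIntegrable hp
  have h_sub := intervalIntegral.integral_interval_sub_left (h_int 0 y) (h_int 0 x)
  have h_le := mul_sub_le_intervalIntegral hp hc hxy.le
  have h_pos : 0 < c * (y - x) := mul_pos hc_pos (sub_pos.2 hxy)
  dsimp only
  linarith

theorem surjective_primitive (hp : LocallyIntegrable p) (hc_pos : 0 < c) (hc : ∀ x, c ≤ p x) :
    Function.Surjective fun x => ∫ s in (0 : ℝ)..x, p s := by
  refine (intervalIntegral.continuous_primitive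
    (intervalIntegrable_of_locallyIntegrable hp) 0).surjective ?_ ?_
  · refine tendsto_atTop_mono' atTop ?_ (tendsto_id.const_mul_atTop hc_pos)
    filter_upwards [eventually_ge_atTop 0] with x hx
    simpa using mul_sub_le_intervalIntegral hp hc hx
  · refine tendsto_atBot_mono' atBot ?_ (tendsto_id.const_mul_atBot hc_pos)
    filter_upwards [eventually_le_atBot 0] with x hx
    have h_le := mul_sub_le_intervalIntegral hp hc hx
    rw [intervalIntegral.integral_symm]
    simp only [id]
    linarith

end Primitive

theorem exists_isReparam {p : ℝ → ℝ} (hp : Measurable p) (hp_loc : LocallyIntegrable p) {c : ℝ}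
    (hc_pos : 0 < c) (hc : ∀ x, c ≤ p x) : ∃ ψ, IsReparam p ψ := by
  have h_int := intervalIntegrable_of_locallyIntegrable hp_loc
  have h_mono := strictMono_primitive hp_loc hc_pos hc
  let e := h_mono.orderIsoOfSurjective _ (surjective_primitive hp_loc hc_pos hc)
  have h_apply (x : ℝ) : e x = ∫ s in (0 : ℝ)..x, p s := rfl
  have h_sub (x y : ℝ) : e y - e x = ∫ s in x..y, p s :=
    intervalIntegral.integral_interval_sub_left (h_int 0 y) (h_int 0 x)
  have h_pos (x : ℝ) : 0 < p x := hc_pos.trans_le (hc x)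
  have h_meas : Measurable e.symm := e.symm.continuous.measurable
  have h_map (a b : ℝ) : Measure.map e.symm volume (Ioc a b) = ENNReal.ofReal (e b - e a) := by
    rw [Measure.map_apply h_meas measurableSet_Ioc, OrderIso.preimage_Ioc, OrderIso.symm_symm,
      Real.volume_Ioc]
  refine ⟨e.symm, hp, h_pos, hp_loc, h_meas, ?_, fun t s => ?_, ?_⟩
  · refine Measure.ext_of_Ioc' _ _ (fun a b _ => ?_) fun a b hab => ?_
    · rw [h_map]
      exact ENNReal.ofReal_ne_top
    · rw [h_map, withDensity_apply _ measurableSet_Ioc, h_sub,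
        intervalIntegral.integral_of_le hab.le, ofReal_integral_eq_lintegral_ofReal
          (h_int a b).1 (Eventually.of_forall fun x => (h_pos x).le)]
  · rw [← h_sub, e.apply_symm_apply, e.apply_symm_apply]
  · rw [e.symm_apply_eq, h_apply, intervalIntegral.integral_same]

namespace IsReparam

variable {p ψ : ℝ → ℝ}

theorem lintegral_comp (h : IsReparam p ψ) {G : ℝ → ℝ≥0∞} (hG : Measurable G) :
    ∫⁻ t, G (ψ t) = ∫⁻ x, ENNReal.ofReal (p x) * G x := by
  rw [← lintegral_map hG h.measurable, h.map_eq,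
    lintegral_withDensity_eq_lintegral_mul _ h.measurable_density.ennreal_ofReal hG]
  rfl

theorem lintegral_lintegral_comp (h : IsReparam p ψ) {G : ℝ → ℝ → ℝ≥0∞}
    (hG : Measurable (Function.uncurry G)) :
    ∫⁻ t, ∫⁻ s, G (ψ t) (ψ s)
      = ∫⁻ x, ∫⁻ y, ENNReal.ofReal (p x) * (ENNReal.ofReal (p y) * G x y) := by
  have h_meas : Measurable fun q : ℝ × ℝ => ENNReal.ofReal (p q.2) * G q.1 q.2 :=
    (h.measurable_density.comp measurable_snd).ennreal_ofReal.mul hG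
  have h_inner (x : ℝ) : ∫⁻ s, G x (ψ s) = ∫⁻ y, ENNReal.ofReal (p y) * G x y :=
    h.lintegral_comp (hG.comp measurable_prodMk_left)
  simp only [h_inner]
  rw [h.lintegral_comp h_meas.lintegral_prod_right']
  exact lintegral_congr fun x => (lintegral_const_mul _ (h_meas.comp measurable_prodMk_left)).symm

theorem abs_sub_le_of_le_one (h : IsReparam p ψ) (hp : ∀ x, p x ≤ 1) (t s : ℝ) :
    |t - s| ≤ |ψ t - ψ s| := by
  rw [h.abs_sub_eq t s, ← one_mul |ψ t - ψ s|]
  refine intervalIntegral.norm_integral_le_of_norm_le_const (f := p) fun x _ => ?_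
  rw [Real.norm_eq_abs, abs_of_pos (h.density_pos x)]
  exact hp x

theorem abs_comp_sub_le_of_one_le (h : IsReparam p ψ) (hp : ∀ x, 1 ≤ p x) (t s : ℝ) :
    |ψ t - ψ s| ≤ |t - s| := by
  wlog hst : ψ s ≤ ψ t generalizing s t
  · rw [abs_sub_comm, abs_sub_comm t]
    exact this s t (le_of_not_ge hst)
  rw [h.abs_sub_eq t s, abs_of_nonneg (sub_nonneg.2 hst), ← one_mul (ψ t - ψ s)]
  exact (mul_sub_le_intervalIntegral h.locallyIntegrable hp hst).trans (le_abs_self _)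

theorem abs_le_setIntegral (h : IsReparam p ψ) {t R : ℝ} (ht : |ψ t| ≤ R) :
    |t| ≤ ∫ x in Icc (-R) R, p x := by
  have h_abs := h.abs_sub_eq t 0
  rw [sub_zero, h.map_zero] at h_abs
  rw [h_abs, intervalIntegral.abs_integral_eq_abs_integral_uIoc,
    abs_of_nonneg (integral_nonneg fun x => (h.density_pos x).le)]
  refine setIntegral_mono_set (h.locallyIntegrable.integrableOn_isCompact isCompact_Icc)
    (Eventually.of_forall fun x => (h.density_pos x).le) (LE.le.eventuallyLE ?_)
  obtain ⟨h_left, h_right⟩ := abs_le.1 ht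
  exact uIoc_subset_uIcc.trans (uIcc_subset_Icc ⟨by linarith, by linarith⟩ ⟨h_left, h_right⟩)

end IsReparam

section Reparam

variable {p ψ k f : ℝ → ℝ}

theorem IsReparam.kernelEnergy_le_of_shrink (h : IsReparam p ψ) (hk : IsBumpKernel k)
    (hp : ∀ x, p x ≤ 1) (hp_eq : ∀ x, f x ≠ 0 → p x = 1) (hm : Measurable f) (hf : MemLp f 2)
    (hf_nonneg : ∀ x, 0 ≤ f x) (hg : MemLp (fun t => f (ψ t)) 2) :
    kernelEnergy k f ≤ kernelEnergy k fun t => f (ψ t) := by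
  rw [← ENNReal.ofReal_le_ofReal_iff (hk.kernelEnergy_nonneg fun x => hf_nonneg _),
    ← hk.lintegral_energy hf hf_nonneg, ← hk.lintegral_energy hg fun x => hf_nonneg _]
  have h_meas : Measurable (Function.uncurry fun x y : ℝ =>
      ENNReal.ofReal (k (x - y) * (f x * f y))) :=
    (hk.measurable_sub.mul
      ((hm.comp measurable_fst).mul (hm.comp measurable_snd))).ennreal_ofReal
  calc ∫⁻ x, ∫⁻ y, ENNReal.ofReal (k (x - y) * (f x * f y))
      = ∫⁻ x, ∫⁻ y, ENNReal.ofReal (p x) * (ENNReal.ofReal (p y) *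
          ENNReal.ofReal (k (x - y) * (f x * f y))) := by
        refine lintegral_congr fun x => lintegral_congr fun y => ?_
        by_cases hx : f x = 0
        · simp [hx]
        by_cases hy : f y = 0
        · simp [hy]
        simp [hp_eq x hx, hp_eq y hy]
    _ = ∫⁻ t, ∫⁻ s, ENNReal.ofReal (k (ψ t - ψ s) * (f (ψ t) * f (ψ s))) :=
        (h.lintegral_lintegral_comp h_meas).symm
    _ ≤ ∫⁻ t, ∫⁻ s, ENNReal.ofReal (k (t - s) * (f (ψ t) * f (ψ s))) :=
        lintegral_mono fun t => lintegral_mono fun s => ENNReal.ofReal_le_ofReal <|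
          mul_le_mul_of_nonneg_right (hk.apply_le_of_abs_le (h.abs_sub_le_of_le_one hp t s))
            (mul_nonneg (hf_nonneg _) (hf_nonneg _))

theorem IsReparam.lintegral_dirichlet_le_of_stretch {B : ℝ} (hB : 0 < B)
    (h : IsReparam (fun x => stretchDensity B (f x)) ψ) (hk : IsBumpKernel k)
    (hm : Measurable f) (hf_nonneg : ∀ x, 0 ≤ f x) :
    ∫⁻ t, ∫⁻ s, ENNReal.ofReal (k (t - s) * (min (f (ψ t)) B - min (f (ψ s)) B) ^ 2)
      ≤ ∫⁻ x, ∫⁻ y, ENNReal.ofReal (k (x - y) * (f x - f y) ^ 2) := by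
  have h_min : Measurable fun x => min (f x) B := hm.min measurable_const
  have h_meas : Measurable (Function.uncurry fun x y : ℝ =>
      ENNReal.ofReal (k (x - y) * (min (f x) B - min (f y) B) ^ 2)) :=
    (hk.measurable_sub.mul
      (((h_min.comp measurable_fst).sub (h_min.comp measurable_snd)).pow_const 2)).ennreal_ofReal
  have hp (x : ℝ) : 1 ≤ stretchDensity B (f x) := one_le_stretchDensity hB.le _
  have hp_nonneg (x : ℝ) : 0 ≤ stretchDensity B (f x) := zero_le_one.trans (hp x)
  calc ∫⁻ t, ∫⁻ s, ENNReal.ofReal (k (t - s) * (min (f (ψ t)) B - min (f (ψ s)) B) ^ 2)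
      ≤ ∫⁻ t, ∫⁻ s,
          ENNReal.ofReal (k (ψ t - ψ s) * (min (f (ψ t)) B - min (f (ψ s)) B) ^ 2) :=
        lintegral_mono fun t => lintegral_mono fun s => ENNReal.ofReal_le_ofReal <|
          mul_le_mul_of_nonneg_right (hk.apply_le_of_abs_le (h.abs_comp_sub_le_of_one_le hp t s))
            (sq_nonneg _)
    _ = ∫⁻ x, ∫⁻ y, ENNReal.ofReal (stretchDensity B (f x)) *
          (ENNReal.ofReal (stretchDensity B (f y)) *
            ENNReal.ofReal (k (x - y) * (min (f x) B - min (f y) B) ^ 2)) :=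
        h.lintegral_lintegral_comp h_meas
    _ ≤ ∫⁻ x, ∫⁻ y, ENNReal.ofReal (k (x - y) * (f x - f y) ^ 2) := by
        refine lintegral_mono fun x => lintegral_mono fun y => ?_
        rw [← ENNReal.ofReal_mul (hp_nonneg y), ← ENNReal.ofReal_mul (hp_nonneg x),
          mul_left_comm _ (k (x - y)), mul_left_comm _ (k (x - y)),
          ← mul_assoc (stretchDensity B _)]
        exact ENNReal.ofReal_le_ofReal <| mul_le_mul_of_nonneg_left
          (stretchDensity_mul_stretchDensity_mul_sq_le hB (hf_nonneg x) (hf_nonneg y))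
          (hk.nonneg _)

theorem IsReparam.kernelEnergy_sub_le_of_stretch {B : ℝ} (hB : 0 < B)
    (h : IsReparam (fun x => stretchDensity B (f x)) ψ) (hk : IsBumpKernel k)
    (hm : Measurable f) (hf : MemLp f 2) (hf_nonneg : ∀ x, 0 ≤ f x)
    (hg : MemLp (fun t => min (f (ψ t)) B) 2) :
    kernelEnergy k f - kernelEnergy k (fun t => min (f (ψ t)) B)
      ≤ (∫ x, f x ^ 2) - ∫ t, min (f (ψ t)) B ^ 2 := by
  have h_le := h.lintegral_dirichlet_le_of_stretch hB hk hm hf_nonneg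
  rw [hk.lintegral_dirichlet hg, hk.lintegral_dirichlet hf, ENNReal.ofReal_le_ofReal_iff
    (mul_nonneg zero_le_two (sub_nonneg.2 (hk.kernelEnergy_le hf)))] at h_le
  linarith

end Reparam

/-- Up to the level set of `0`, the function `g` has the distribution of `φ ∘ f` under the measure
`w (f x) dx`. This records what reparametrising the line by the density `w ∘ f` does to the
integrals `∫ G (g t) dt` with `G 0 = 0`. -/
def IsTransport (w φ f g : ℝ → ℝ) : Prop :=
  ∀ G : ℝ → ℝ≥0∞, Measurable G → G 0 = 0 →
    ∫⁻ t, G (g t) = ∫⁻ x, ENNReal.ofReal (w (f x)) * G (φ (f x))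

theorem isTransport_one_comp (φ f : ℝ → ℝ) : IsTransport (fun _ => 1) φ f fun x => φ (f x) :=
  fun G _ _ => by simp

theorem IsReparam.isTransport {w φ f ψ : ℝ → ℝ} (h : IsReparam (fun x => w (f x)) ψ)
    (hφ : Measurable φ) (hf : Measurable f) : IsTransport w φ f fun t => φ (f (ψ t)) :=
  fun _ hG _ => h.lintegral_comp (hG.comp (hφ.comp hf))

namespace IsTransport

variable {w φ f g G : ℝ → ℝ}

theorem trans {w' φ' g' : ℝ → ℝ} (h : IsTransport w φ f g) (h' : IsTransport w' φ' g g')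
    (hw : ∀ y, 0 ≤ w y) (hw'_meas : Measurable w') (hφ'_meas : Measurable φ') (hφ' : φ' 0 = 0) :
    IsTransport (fun y => w y * w' (φ y)) (fun y => φ' (φ y)) f g' := fun G hG hG_zero => by
  rw [h' G hG hG_zero, h (fun y => ENNReal.ofReal (w' y) * G (φ' y))
    (hw'_meas.ennreal_ofReal.mul (hG.comp hφ'_meas)) (by simp [hφ', hG_zero])]
  refine lintegral_congr fun x => ?_
  rw [ENNReal.ofReal_mul (hw _), mul_assoc]

theorem lintegral_ofReal (h : IsTransport w φ f g) (hw : ∀ y, 0 ≤ w y) (hG : Measurable G)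
    (hG_zero : G 0 = 0) :
    ∫⁻ t, ENNReal.ofReal (G (g t)) = ∫⁻ x, ENNReal.ofReal (w (f x) * G (φ (f x))) := by
  simpa only [ENNReal.ofReal_mul (hw _)] using
    h (fun y => ENNReal.ofReal (G y)) hG.ennreal_ofReal (by simp [hG_zero])

theorem integrable_comp (h : IsTransport w φ f g) (hw : ∀ y, 0 ≤ w y) (hG : Measurable G)
    (hG_nonneg : ∀ y, 0 ≤ G y) (hG_zero : G 0 = 0) (hg : Measurable g)
    (h_int : Integrable fun x => w (f x) * G (φ (f x))) : Integrable fun t => G (g t) := by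
  refine ⟨(hG.comp hg).aestronglyMeasurable, ?_⟩
  rw [hasFiniteIntegral_iff_ofReal (Eventually.of_forall fun t => hG_nonneg _),
    h.lintegral_ofReal hw hG hG_zero]
  exact h_int.lintegral_lt_top

theorem integral_comp (h : IsTransport w φ f g) (hw : ∀ y, 0 ≤ w y) (hG : Measurable G)
    (hG_nonneg : ∀ y, 0 ≤ G y) (hG_zero : G 0 = 0) (hg : Measurable g)
    (h_int : Integrable fun x => w (f x) * G (φ (f x))) :
    ∫ t, G (g t) = ∫ x, w (f x) * G (φ (f x)) := by
  rw [integral_eq_lintegral_of_nonneg_ae (Eventually.of_forall fun t => hG_nonneg _)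
      (hG.comp hg).aestronglyMeasurable, h.lintegral_ofReal hw hG hG_zero,
    integral_eq_lintegral_of_nonneg_ae
      (Eventually.of_forall fun x => mul_nonneg (hw _) (hG_nonneg _)) h_int.aestronglyMeasurable]

theorem memLp_two (h : IsTransport w φ f g) (hw : ∀ y, 0 ≤ w y) (hg : Measurable g)
    (h_int : Integrable fun x => w (f x) * φ (f x) ^ 2) : MemLp g 2 :=
  (memLp_two_iff_integrable_sq hg.aestronglyMeasurable).2 <|
    h.integrable_comp hw (measurable_id.pow_const 2) (fun y => sq_nonneg y) (by simp) hg h_int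

theorem integral_sq (h : IsTransport w φ f g) (hw : ∀ y, 0 ≤ w y) (hg : Measurable g)
    (h_int : Integrable fun x => w (f x) * φ (f x) ^ 2) :
    ∫ t, g t ^ 2 = ∫ x, w (f x) * φ (f x) ^ 2 :=
  h.integral_comp hw (measurable_id.pow_const 2) (fun y => sq_nonneg y) (by simp) hg h_int

end IsTransport

/-- The factor `ε` by which the line is shrunk on the zero set of a function in order to close the
gaps of its support. -/
noncomputable def gapDensity (ε y : ℝ) : ℝ := if y = 0 then ε else 1

theorem gapDensity_of_ne_zero {ε y : ℝ} (h : y ≠ 0) : gapDensity ε y = 1 := if_neg h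

theorem gapDensity_le_one {ε : ℝ} (hε : ε ≤ 1) (y : ℝ) : gapDensity ε y ≤ 1 := by
  unfold gapDensity
  split_ifs <;> simp [hε]

theorem le_gapDensity {ε : ℝ} (hε : ε ≤ 1) (y : ℝ) : ε ≤ gapDensity ε y := by
  unfold gapDensity
  split_ifs <;> simp [hε]

theorem measurable_gapDensity (ε : ℝ) : Measurable (gapDensity ε) :=
  Measurable.ite (measurableSet_singleton 0) measurable_const measurable_const

theorem setIntegral_gapDensity_le {f : ℝ → ℝ} (hf : Measurable f) {R ε : ℝ} (hR : 0 ≤ R)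
    (hε : 0 ≤ ε) (hs : ∀ x, f x ≠ 0 → |x| ≤ R)
    (h_loc : LocallyIntegrable fun x => gapDensity ε (f x)) :
    ∫ x in Icc (-R) R, gapDensity ε (f x)
      ≤ volume.real (Function.support f) + 2 * R * ε := by
  have h_meas : MeasurableSet (Function.support f) := measurableSet_support hf
  have h_fin : volume (Function.support f) ≠ ∞ :=
    measure_ne_top_of_subset (fun x hx => abs_le.1 (hs x hx)) (by simp : volume (Icc (-R) R) ≠ ∞)
  have h_one : Integrable ((Function.support f).indicator (1 : ℝ → ℝ)) :=
    (integrable_indicator_iff h_meas).2 (integrableOn_const h_fin)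
  have h_const : IntegrableOn (fun _ : ℝ => ε) (Icc (-R) R) := integrableOn_const (by simp)
  calc ∫ x in Icc (-R) R, gapDensity ε (f x)
      ≤ ∫ x in Icc (-R) R, ((Function.support f).indicator 1 x + ε) := by
        refine setIntegral_mono (h_loc.integrableOn_isCompact isCompact_Icc)
          (h_one.integrableOn.add h_const) fun x => ?_
        by_cases hx : f x = 0 <;> simp [gapDensity, hx, hε]
    _ = (∫ x in Icc (-R) R, (Function.support f).indicator 1 x) + 2 * R * ε := by
        rw [integral_add h_one.integrableOn h_const, setIntegral_const,
          Real.volume_real_Icc_of_le (by linarith), smul_eq_mul]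
        ring
    _ ≤ (∫ x, (Function.support f).indicator 1 x) + 2 * R * ε := by
        gcongr
        · exact Eventually.of_forall (indicator_nonneg fun _ _ => zero_le_one)
        · exact Measure.restrict_le_self
    _ = volume.real (Function.support f) + 2 * R * ε := by rw [integral_indicator_one h_meas]

theorem exists_closeGaps {f : ℝ → ℝ} (hm : Measurable f) (hf : MemLp f 2)
    (hf_nonneg : ∀ x, 0 ≤ f x) {R : ℝ} (hR : 0 ≤ R) (hs : ∀ x, f x ≠ 0 → |x| ≤ R) :
    ∃ g : ℝ → ℝ, Measurable g ∧ MemLp g 2 ∧ (∀ t, 0 ≤ g t) ∧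
      (∀ t, g t ≠ 0 → |t| ≤ volume.real (Function.support f) + 1) ∧
      IsTransport (fun _ => 1) id f g ∧
      ∀ k, IsBumpKernel k → kernelEnergy k f ≤ kernelEnergy k g := by
  set ε := (2 * R + 1)⁻¹ with hε
  have hε_pos : 0 < ε := by positivity
  have hε_le : ε ≤ 1 := inv_le_one_of_one_le₀ (by linarith)
  have hp_le (x : ℝ) : gapDensity ε (f x) ≤ 1 := gapDensity_le_one hε_le _
  have hp_ge (x : ℝ) : ε ≤ gapDensity ε (f x) := le_gapDensity hε_le _
  have hp_meas : Measurable fun x => gapDensity ε (f x) := (measurable_gapDensity ε).comp hm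
  have hp_loc : LocallyIntegrable fun x => gapDensity ε (f x) :=
    (locallyIntegrable_const (1 : ℝ)).mono hp_meas.aestronglyMeasurable <|
      Eventually.of_forall fun x => by
        rw [Real.norm_of_nonneg (hε_pos.le.trans (hp_ge x)), norm_one]
        exact hp_le x
  obtain ⟨ψ, hψ⟩ := exists_isReparam hp_meas hp_loc hε_pos hp_ge
  have hg_meas : Measurable fun t => f (ψ t) := hm.comp hψ.measurable
  have h_transport : IsTransport (fun _ => 1) id f fun t => f (ψ t) := fun G hG hG_zero => by
    refine (hψ.isTransport measurable_id hm G hG hG_zero).trans <|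
      lintegral_congr fun x => ?_
    by_cases hx : f x = 0
    · simp [hx, hG_zero]
    · simp [gapDensity_of_ne_zero hx]
  have hg : MemLp (fun t => f (ψ t)) 2 := h_transport.memLp_two (fun _ => zero_le_one) hg_meas
    (by simpa using hf.integrable_sq)
  refine ⟨fun t => f (ψ t), hg_meas, hg, fun t => hf_nonneg _, fun t ht => ?_, h_transport,
    fun k hk => hψ.kernelEnergy_le_of_shrink hk hp_le (fun x hx => gapDensity_of_ne_zero hx) hm hf
      hf_nonneg hg⟩
  refine (hψ.abs_le_setIntegral (hs _ ht)).trans <|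
    (setIntegral_gapDensity_le hm hR hε_pos.le hs hp_loc).trans ?_
  gcongr
  rw [hε, ← div_eq_mul_inv, div_le_one (by positivity)]
  linarith

theorem integrable_stretchDensity_mul_min_sq {f : ℝ → ℝ} (hm : Measurable f) (hf : MemLp f 2)
    {B : ℝ} (hB : 0 < B) : Integrable fun x => stretchDensity B (f x) * min (f x) B ^ 2 := by
  refine hf.integrable_sq.mono' (by fun_prop) (Eventually.of_forall fun x => ?_)
  have h_nonneg : 0 ≤ stretchDensity B (f x) := zero_le_one.trans (one_le_stretchDensity hB.le _)
  rw [Real.norm_of_nonneg (by positivity), stretchDensity_mul_min_sq hB.ne']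
  exact sub_le_self _ (sq_nonneg _)

theorem exists_stretch {f : ℝ → ℝ} (hm : Measurable f) (hf : MemLp f 2)
    (hf_nonneg : ∀ x, 0 ≤ f x) {R B : ℝ} (hR : 0 ≤ R) (hs : ∀ x, f x ≠ 0 → |x| ≤ R)
    (hB : 0 < B) :
    ∃ g : ℝ → ℝ, Measurable g ∧ MemLp g 2 ∧
      (∀ t, g t ≠ 0 → |t| ≤ 2 * R + 2 / B ^ 2 * ∫ x, f x ^ 2) ∧
      IsTransport (stretchDensity B) (fun y => min y B) f g ∧
      ∀ k, IsBumpKernel k →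
        kernelEnergy k f - kernelEnergy k g ≤ (∫ x, f x ^ 2) - ∫ t, g t ^ 2 := by
  have hp_ge (y : ℝ) : 1 ≤ stretchDensity B y := one_le_stretchDensity hB.le y
  have hp_nonneg (y : ℝ) : 0 ≤ stretchDensity B y := zero_le_one.trans (hp_ge y)
  have hp_meas : Measurable fun x => stretchDensity B (f x) := by fun_prop
  have h_sq : Integrable fun x => 2 / B ^ 2 * f x ^ 2 := hf.integrable_sq.const_mul _
  have h_sq_nonneg (x : ℝ) : 0 ≤ 2 / B ^ 2 * f x ^ 2 := by positivity
  have h_bound : LocallyIntegrable fun x => 1 + 2 / B ^ 2 * f x ^ 2 :=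
    (locallyIntegrable_const (1 : ℝ)).add h_sq.locallyIntegrable
  have hp_loc : LocallyIntegrable fun x => stretchDensity B (f x) :=
    h_bound.mono hp_meas.aestronglyMeasurable <| Eventually.of_forall fun x => by
      rw [Real.norm_of_nonneg (hp_nonneg _)]
      exact (stretchDensity_le hB _).trans (le_abs_self _)
  obtain ⟨ψ, hψ⟩ := exists_isReparam hp_meas hp_loc one_pos fun x => hp_ge (f x)
  have hg_meas : Measurable fun t => min (f (ψ t)) B := (hm.comp hψ.measurable).min measurable_const
  have h_transport : IsTransport (stretchDensity B) (fun y => min y B) f fun t => min (f (ψ t)) B :=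
    hψ.isTransport (by fun_prop) hm
  have hg : MemLp (fun t => min (f (ψ t)) B) 2 :=
    h_transport.memLp_two hp_nonneg hg_meas (integrable_stretchDensity_mul_min_sq hm hf hB)
  refine ⟨fun t => min (f (ψ t)) B, hg_meas, hg, fun t ht => ?_, h_transport,
    fun k hk => hψ.kernelEnergy_sub_le_of_stretch hB hk hm hf hf_nonneg hg⟩
  have hf_ne : f (ψ t) ≠ 0 := fun h_zero => ht (by simp [h_zero, hB.le])
  have h_const : IntegrableOn (fun _ : ℝ => (1 : ℝ)) (Icc (-R) R) := integrableOn_const (by simp)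
  calc |t| ≤ ∫ x in Icc (-R) R, stretchDensity B (f x) := hψ.abs_le_setIntegral (hs _ hf_ne)
    _ ≤ ∫ x in Icc (-R) R, (1 + 2 / B ^ 2 * f x ^ 2) :=
        setIntegral_mono (hp_loc.integrableOn_isCompact isCompact_Icc)
          (h_const.add h_sq.integrableOn) fun x => stretchDensity_le hB _
    _ = 2 * R + ∫ x in Icc (-R) R, 2 / B ^ 2 * f x ^ 2 := by
        rw [integral_add h_const h_sq.integrableOn, setIntegral_const,
          Real.volume_real_Icc_of_le (by linarith), smul_eq_mul]
        ring
    _ ≤ 2 * R + ∫ x, 2 / B ^ 2 * f x ^ 2 := by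
        gcongr
        · exact Eventually.of_forall h_sq_nonneg
        · exact Measure.restrict_le_self
    _ = 2 * R + 2 / B ^ 2 * ∫ x, f x ^ 2 := by rw [integral_const_mul]

theorem integrable_of_memLp_two_of_support {f : ℝ → ℝ} {R : ℝ} (hf : MemLp f 2)
    (hs : ∀ x, f x ≠ 0 → |x| ≤ R) : Integrable f :=
  (integrableOn_iff_integrable_of_support_subset fun x hx => abs_le.1 (hs x hx)).1 <|
    (hf.restrict (Icc (-R) R)).integrable one_le_two

theorem volume_real_support_softThreshold_le {f : ℝ → ℝ} (hf : MemLp f 2) {δ : ℝ} (hδ : 0 < δ) :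
    volume.real (Function.support fun x => softThreshold δ (f x)) ≤ (∫ x, f x ^ 2) / δ ^ 2 := by
  have h_subset : (Function.support fun x => softThreshold δ (f x)) ⊆ {x | δ ^ 2 ≤ f x ^ 2} :=
    fun x hx => by
      rw [mem_ofPred_eq, ← sq_abs (f x)]
      exact pow_le_pow_left₀ hδ.le (le_abs_of_softThreshold_ne_zero hx) 2
  have h_fin := (hf.integrable_sq.measure_ge_lt_top (by positivity : 0 < δ ^ 2)).ne
  rw [le_div_iff₀' (by positivity)]
  calc δ ^ 2 * volume.real (Function.support fun x => softThreshold δ (f x))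
      ≤ δ ^ 2 * volume.real {x | δ ^ 2 ≤ f x ^ 2} := by
        gcongr
    _ ≤ ∫ x, f x ^ 2 := mul_meas_ge_le_integral_of_nonneg
        (Eventually.of_forall fun x => sq_nonneg _) hf.integrable_sq _

theorem memLp_softThreshold {f : ℝ → ℝ} (hm : Measurable f) (hf : MemLp f 2) {δ : ℝ}
    (hδ : 0 ≤ δ) : MemLp (fun x => softThreshold δ (f x)) 2 :=
  hf.of_le ((measurable_softThreshold δ).comp hm).aestronglyMeasurable <|
    Eventually.of_forall fun x => by
      rw [Real.norm_of_nonneg (softThreshold_nonneg _ _)]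
      exact softThreshold_le_abs hδ _

theorem integral_softThreshold_sq_le {f : ℝ → ℝ} (hm : Measurable f) (hf : MemLp f 2) {δ : ℝ}
    (hδ : 0 ≤ δ) : ∫ x, softThreshold δ (f x) ^ 2 ≤ ∫ x, f x ^ 2 :=
  integral_mono (memLp_softThreshold hm hf hδ).integrable_sq hf.integrable_sq fun x => by
    rw [← sq_abs (f x)]
    exact pow_le_pow_left₀ (softThreshold_nonneg _ _) (softThreshold_le_abs hδ _) 2

theorem exists_truncation {f : ℝ → ℝ} (hm : Measurable f) (hf : MemLp f 2) {R δ B : ℝ}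
    (hR : 0 ≤ R) (hs : ∀ x, f x ≠ 0 → |x| ≤ R) (hδ : 0 < δ) (hB : 0 < B) :
    ∃ g : ℝ → ℝ, Measurable g ∧ MemLp g 2 ∧
      (∀ t, g t ≠ 0 → |t| ≤ 2 * ((∫ x, f x ^ 2) / δ ^ 2 + 1) + 2 / B ^ 2 * ∫ x, f x ^ 2) ∧
      IsTransport (fun y => stretchDensity B (softThreshold δ y))
        (fun y => min (softThreshold δ y) B) f g ∧
      ∀ m : ℝ → ℝ, IsGaussianMixture m →
        symbolEnergy m f - symbolEnergy m g ≤ ((∫ x, f x ^ 2) - ∫ t, g t ^ 2) * m 0 := by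
  set f₁ := fun x => softThreshold δ (f x)
  have hm₁ : Measurable f₁ := by fun_prop
  have hf₁ : MemLp f₁ 2 := memLp_softThreshold hm hf hδ.le
  have hs₁ (x : ℝ) (hx : f₁ x ≠ 0) : |x| ≤ R := hs x fun h_zero => by
    have := le_abs_of_softThreshold_ne_zero hx
    rw [h_zero, abs_zero] at this
    exact this.not_gt hδ
  obtain ⟨f₂, hm₂, hf₂, hf₂_nonneg, hs₂, h_close, h_close_energy⟩ :=
    exists_closeGaps hm₁ hf₁ (fun x => softThreshold_nonneg _ _) hR hs₁
  have h_sq : ∫ x, f₂ x ^ 2 = ∫ x, f₁ x ^ 2 := by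
    simpa using h_close.integral_sq (fun _ => zero_le_one) hm₂ (by simpa using hf₁.integrable_sq)
  obtain ⟨g, hg_meas, hg, hs_g, h_stretch, h_stretch_energy⟩ :=
    exists_stretch hm₂ hf₂ hf₂_nonneg (by positivity) hs₂ hB
  have hf_int := integrable_of_memLp_two_of_support hf hs
  have hg_int := integrable_of_memLp_two_of_support hg hs_g
  refine ⟨g, hg_meas, hg, fun t ht => (hs_g t ht).trans ?_, ?_, fun m h_mix => ?_⟩
  · have h_volume := volume_real_support_softThreshold_le hf hδ
    have h_sq_le := integral_softThreshold_sq_le hm hf hδ.le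
    rw [h_sq]
    gcongr
  · have h_one (y : ℝ) : (0 : ℝ) ≤ (fun _ => 1) y := zero_le_one
    simpa using (isTransport_one_comp (softThreshold δ) f).trans
      (h_close.trans h_stretch h_one (by fun_prop) (by fun_prop) (min_eq_left hB.le)) h_one
      (by fun_prop) (by fun_prop) (min_eq_left hB.le)
  · refine h_mix.symbolEnergy_sub_le_of_gauss hf_int hf hg_int hg fun t ht => ?_
    have hk := isBumpKernel_gaussKernel ht
    rw [symbolEnergy_gauss ht hf_int, symbolEnergy_gauss ht hg_int]
    have h_threshold := hk.kernelEnergy_sub_le_of_contraction hf hf₁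
      fun x y => abs_softThreshold_sub_le δ (f x) (f y)
    linarith [h_close_energy _ hk, h_stretch_energy _ hk]

section OrliczNorm

variable {a : ℝ} {f : ℝ → ℝ}

theorem modular_div_le_one (ha : 0 < a) (hf : 0 < gaugeNorm a f) {r : ℝ}
    (hr : gaugeNorm a f < r) : modular a (fun x => f x / r) ≤ 1 := by
  have h_nonempty : {r : ℝ | 0 < r ∧ modular a (fun x => f x / r) ≤ 1}.Nonempty := by
    by_contra h
    rw [gaugeNorm, not_nonempty_iff_eq_empty.1 h, Real.sInf_empty] at hf
    exact hf.false
  obtain ⟨s, ⟨hs_pos, hs⟩, hsr⟩ := exists_lt_of_csInf_lt h_nonempty hr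
  refine (lintegral_mono fun x => ENNReal.ofReal_le_ofReal ?_).trans hs
  rw [← youngPsi_abs a (f x / r), ← youngPsi_abs a (f x / s)]
  refine monotoneOn_youngPsi ha (mem_Ici.2 (abs_nonneg _)) (mem_Ici.2 (abs_nonneg _)) ?_
  rw [abs_div, abs_div, abs_of_pos hs_pos, abs_of_pos (hs_pos.trans hsr)]
  gcongr

theorem modular_div_gaugeNorm_le_one (ha : 0 < a) (hm : AEStronglyMeasurable f)
    (hf : 0 < gaugeNorm a f) : modular a (fun x => f x / gaugeNorm a f) ≤ 1 := by
  obtain ⟨r, -, hr, h_lim⟩ := exists_seq_strictAnti_tendsto (gaugeNorm a f)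
  have h_tendsto (x : ℝ) : Tendsto (fun k => ENNReal.ofReal (youngPsi a (f x / r k))) atTop
      (nhds (ENNReal.ofReal (youngPsi a (f x / gaugeNorm a f)))) :=
    ENNReal.tendsto_ofReal <| ((continuous_youngPsi a).tendsto _).comp <|
      tendsto_const_nhds.div h_lim hf.ne'
  have h_meas (k : ℕ) : AEMeasurable fun x => ENNReal.ofReal (youngPsi a (f x / r k)) :=
    ((measurable_youngPsi a).comp_aemeasurable (hm.aemeasurable.div_const _)).ennreal_ofReal
  calc modular a (fun x => f x / gaugeNorm a f)
      = ∫⁻ x, liminf (fun k => ENNReal.ofReal (youngPsi a (f x / r k))) atTop :=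
        lintegral_congr fun x => (h_tendsto x).liminf_eq.symm
    _ ≤ liminf (fun k => modular a (fun x => f x / r k)) atTop := lintegral_liminf_le' h_meas
    _ ≤ liminf (fun _ : ℕ => (1 : ℝ≥0∞)) atTop :=
        liminf_le_liminf (Eventually.of_forall fun k => modular_div_le_one ha hf (hr k))
    _ = 1 := liminf_const 1

theorem gaugeNorm_eq_one (ha : 0 < a) (hf : modular a f = 1) : gaugeNorm a f = 1 := by
  have h_one : (1 : ℝ) ∈ {r : ℝ | 0 < r ∧ modular a (fun x => f x / r) ≤ 1} := by
    simp [hf]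
  refine le_antisymm (csInf_le ⟨0, fun r hr => hr.1.le⟩ h_one) (le_csInf ⟨1, h_one⟩ ?_)
  rintro r ⟨hr_pos, hr⟩
  by_contra! hr_lt
  have h_inv : 1 < r⁻¹ := (one_lt_inv₀ hr_pos).2 hr_lt
  have h_scale : ENNReal.ofReal r⁻¹ * modular a f ≤ modular a (fun x => f x / r) := by
    rw [modular, ← lintegral_const_mul' _ _ ENNReal.ofReal_ne_top]
    refine lintegral_mono fun x => ?_
    dsimp only
    rw [← ENNReal.ofReal_mul (zero_le_one.trans h_inv.le), div_eq_inv_mul]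
    exact ENNReal.ofReal_le_ofReal (mul_youngPsi_le ha h_inv.le (f x))
  rw [hf, mul_one] at h_scale
  exact (h_scale.trans hr).not_gt (ENNReal.one_lt_ofReal.2 h_inv)

theorem mem_localConstraint (ha : 0 < a) {l : ℕ} (hm : Measurable f)
    (hi : Integrable fun x => youngPsi a (f x)) (h_one : ∫ x, youngPsi a (f x) = 1)
    (hs : ∀ x, f x ≠ 0 → |x| ≤ 2 ^ l) : f ∈ localConstraint a l := by
  have h_modular : modular a f = 1 := by
    rw [modular, ← ofReal_integral_eq_lintegral_ofReal hi
      (Eventually.of_forall fun x => youngPsi_nonneg ha _), h_one, ENNReal.ofReal_one]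
  refine ⟨⟨hm.aestronglyMeasurable, 1, one_pos, by simp [h_modular]⟩,
    gaugeNorm_eq_one ha h_modular, Eventually.of_forall fun x hx => ?_⟩
  by_contra h
  exact hx (abs_le.1 (hs x h))

theorem memLp_two_of_integrable_youngPsi (ha : 0 < a) (hm : AEStronglyMeasurable f)
    (hi : Integrable fun x => youngPsi a (f x)) : MemLp f 2 := by
  refine (memLp_two_iff_integrable_sq hm).2 <|
    (hi.const_mul (3 / a)).mono' (hm.pow 2) (Eventually.of_forall fun x => ?_)
  rw [Real.norm_of_nonneg (sq_nonneg _)]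
  exact sq_le_div_mul_youngPsi ha _

theorem integral_sq_le_mul_integral_youngPsi (ha : 0 < a) (hf : MemLp f 2)
    (hi : Integrable fun x => youngPsi a (f x)) :
    ∫ x, f x ^ 2 ≤ 3 / a * ∫ x, youngPsi a (f x) := by
  rw [← integral_const_mul]
  exact integral_mono hf.integrable_sq (hi.const_mul _) fun x => sq_le_div_mul_youngPsi ha _

theorem exists_measurable_of_mem_localConstraint (ha : 0 < a) {l : ℕ}
    (hf : f ∈ localConstraint a l) :
    ∃ g : ℝ → ℝ, Measurable g ∧ f =ᵐ[volume] g ∧ (∀ x, g x ≠ 0 → |x| ≤ 2 ^ l) ∧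
      (Integrable fun x => youngPsi a (g x)) ∧ ∫ x, youngPsi a (g x) ≤ 1 := by
  obtain ⟨⟨hm, -⟩, h_norm, h_supp⟩ := hf
  set g := (Icc (-(2 : ℝ) ^ l) (2 ^ l)).indicator (hm.aemeasurable.mk f)
  have hg : Measurable g := hm.aemeasurable.measurable_mk.indicator measurableSet_Icc
  have hfg : f =ᵐ[volume] g := by
    filter_upwards [hm.aemeasurable.ae_eq_mk, h_supp] with x hx hx_supp
    by_cases h : x ∈ Icc (-(2 : ℝ) ^ l) (2 ^ l)
    · exact hx.trans (indicator_of_mem h _).symm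
    · exact (hx_supp h).trans (indicator_of_notMem h _).symm
  have h_modular : ∫⁻ x, ENNReal.ofReal (youngPsi a (g x)) ≤ 1 := by
    have h := modular_div_gaugeNorm_le_one ha hm (h_norm ▸ one_pos)
    simp only [h_norm, div_one] at h
    refine (lintegral_congr_ae ?_).trans_le h
    exact hfg.symm.fun_comp fun y => ENNReal.ofReal (youngPsi a y)
  have h_nonneg : 0 ≤ᵐ[volume] fun x => youngPsi a (g x) :=
    Eventually.of_forall fun x => youngPsi_nonneg ha _
  have h_meas : AEStronglyMeasurable fun x => youngPsi a (g x) :=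
    ((measurable_youngPsi a).comp hg).aestronglyMeasurable
  refine ⟨g, hg, hfg, fun x hx => abs_le.2 (mem_Icc.1 (mem_of_indicator_ne_zero hx)),
    ⟨h_meas, ?_⟩, ?_⟩
  · rw [hasFiniteIntegral_iff_ofReal h_nonneg]
    exact h_modular.trans_lt ENNReal.one_lt_top
  · rw [integral_eq_lintegral_of_nonneg_ae h_nonneg h_meas]
    exact ENNReal.toReal_le_of_le_ofReal zero_le_one (by simpa using h_modular)

end OrliczNorm

theorem dispersiveEnergy_congr_ae {f g : ℝ → ℝ} (h : f =ᵐ[volume] g) :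
    dispersiveEnergy f = dispersiveEnergy g := by
  have h_complex : (fun x => (f x : ℂ)) =ᵐ[volume] fun x => (g x : ℂ) :=
    h.fun_comp Complex.ofReal
  unfold dispersiveEnergy
  by_cases hf : MemLp (fun x => (f x : ℂ)) 2 (volume : Measure ℝ)
  · have hg := (memLp_congr_ae h_complex).1 hf
    rw [dif_pos hf, dif_pos hg, MemLp.toLp_congr hf hg h_complex]
  · rw [dif_neg hf, dif_neg fun hg => hf ((memLp_congr_ae h_complex).2 hg)]

theorem whithamSymbol_zero (s : ℝ) : whithamSymbol s 0 = 1 := if_pos rfl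

theorem continuousAt_whithamSymbol_zero (s : ℝ) : ContinuousAt (whithamSymbol s) 0 := by
  have h_deriv : HasDerivAt Real.tanh 1 0 := by
    have h := (Real.hasDerivAt_sinh 0).div (Real.hasDerivAt_cosh 0) (Real.cosh_pos 0).ne'
    exact (h.congr_deriv (by simp)).congr_of_eventuallyEq
      (Eventually.of_forall Real.tanh_eq_sinh_div_cosh)
  have h_slope : Tendsto (fun x => Real.tanh x / x) (nhdsWithin 0 {0}ᶜ) (nhds 1) := by
    refine (hasDerivAt_iff_tendsto_slope_zero.1 h_deriv).congr fun x => ?_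
    simp [div_eq_inv_mul]
  rw [continuousAt_iff_punctured_nhds, whithamSymbol_zero]
  have h_pow := h_slope.rpow_const (p := s) (Or.inl one_ne_zero)
  rw [Real.one_rpow] at h_pow
  refine h_pow.congr' ?_
  filter_upwards [self_mem_nhdsWithin] with x hx
  exact (if_neg hx).symm

theorem isGaussianMixture_whithamSymbol_sq :
    IsGaussianMixture fun x => whithamSymbol (1 / 4) x ^ 2 :=
  (isGaussianMixture_whithamSymbol (by norm_num)).pow 2

theorem dispersiveEnergy_sq_le {f : ℝ → ℝ} (hf₁ : Integrable f) (hf₂ : MemLp f 2) :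
    dispersiveEnergy f ^ 2 ≤ ∫ x, f x ^ 2 := by
  rw [dispersiveEnergy_sq hf₁ hf₂]
  simpa [whithamSymbol_zero] using isGaussianMixture_whithamSymbol_sq.symbolEnergy_le hf₁ hf₂

section Plateau

theorem integrable_indicator_Icc (r c : ℝ) : Integrable ((Icc (-r) r).indicator fun _ => c) :=
  (integrable_indicator_iff measurableSet_Icc).2 (integrableOn_const (by simp))

theorem integral_indicator_Icc {r : ℝ} (hr : 0 ≤ r) (c : ℝ) :
    ∫ x, (Icc (-r) r).indicator (fun _ => c) x = 2 * r * c := by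
  rw [integral_indicator measurableSet_Icc, setIntegral_const,
    Real.volume_real_Icc_of_le (by linarith), smul_eq_mul]
  ring

theorem memLp_indicator_Icc (r c : ℝ) : MemLp ((Icc (-r) r).indicator fun _ => c) 2 :=
  memLp_indicator_const 2 measurableSet_Icc c (Or.inr (by simp))

theorem indicator_mem_localConstraint {a : ℝ} (ha : 0 < a) {l : ℕ} {A : ℝ}
    (hA : youngPsi a A = 1 / (2 * 2 ^ l)) :
    (Icc (-(2 : ℝ) ^ l) (2 ^ l)).indicator (fun _ => A) ∈ localConstraint a l := by
  have h_comp : (fun x => youngPsi a ((Icc (-(2 : ℝ) ^ l) (2 ^ l)).indicator (fun _ => A) x))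
      = (Icc (-(2 : ℝ) ^ l) (2 ^ l)).indicator fun _ => 1 / (2 * 2 ^ l) := by
    rw [← hA]
    exact (indicator_comp_of_zero (g := youngPsi a) (youngPsi_zero ha)).symm
  refine mem_localConstraint ha (measurable_const.indicator measurableSet_Icc) ?_ ?_
    fun x hx => abs_le.2 (mem_Icc.1 (mem_of_indicator_ne_zero hx))
  · rw [h_comp]
    exact integrable_indicator_Icc _ _
  · rw [h_comp, integral_indicator_Icc (by positivity), mul_one_div_cancel (by positivity)]

theorem dispersiveEnergy_indicator_sq {r : ℝ} (hr : 0 < r) (A : ℝ) :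
    dispersiveEnergy ((Icc (-r) r).indicator fun _ => A) ^ 2
      = A ^ 2 * (r * symbolEnergy (fun x => whithamSymbol (1 / 4) (x / r) ^ 2)
        ((Icc (-1) 1).indicator fun _ => 1)) := by
  have h_scale : (Icc (-r) r).indicator (fun _ => A)
      = fun x => A * (Icc (-1) 1).indicator (fun _ => 1) (x / r) := by
    ext x
    have h_mem : x / r ∈ Icc (-1 : ℝ) 1 ↔ x ∈ Icc (-r) r := by
      rw [mem_Icc, mem_Icc, le_div_iff₀ hr, div_le_one hr, neg_one_mul]
    by_cases hx : x ∈ Icc (-r) r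
    · simp [hx, h_mem.2 hx]
    · simp [hx, mt h_mem.1 hx]
  rw [dispersiveEnergy_sq (integrable_indicator_Icc r A) (memLp_indicator_Icc r A), h_scale,
    symbolEnergy_const_mul, symbolEnergy_comp_div hr]

/-- Low and wide plateaus satisfy `Ψ(A) ≈ a A²`, so their energy squared tends to `1 / a`. -/
theorem eventually_exists_dispersiveEnergy_ge {a σ : ℝ} (ha : 0 < a) (hσ : 0 < σ) (hσ' : σ ≤ 1) :
    ∀ᶠ l : ℕ in atTop, ∃ f ∈ localConstraint a l, 1 - σ ≤ a * dispersiveEnergy f ^ 2 := by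
  have h_pow : Tendsto (fun l : ℕ => (2 : ℝ) ^ l) atTop atTop :=
    tendsto_pow_atTop_atTop_of_one_lt one_lt_two
  have h_lim := isGaussianMixture_whithamSymbol_sq.tendsto_symbolEnergy_comp_div
    ((continuousAt_whithamSymbol_zero _).pow 2) (integrable_indicator_Icc 1 1)
    (memLp_indicator_Icc 1 1) h_pow
  have h_sq : ∫ x, (Icc (-1 : ℝ) 1).indicator (fun _ => (1 : ℝ)) x ^ 2 = 2 := by
    have h (x : ℝ) : (Icc (-1 : ℝ) 1).indicator (fun _ => (1 : ℝ)) x ^ 2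
        = (Icc (-1 : ℝ) 1).indicator (fun _ => 1) x := by
      by_cases hx : x ∈ Icc (-1 : ℝ) 1 <;> simp [hx]
    simp only [h, integral_indicator_Icc zero_le_one, mul_one]
  rw [whithamSymbol_zero, one_pow, h_sq, one_mul] at h_lim
  filter_upwards [h_lim.eventually (lt_mem_nhds (by linarith : 2 * (1 - σ) < 2)),
    h_pow.eventually_ge_atTop (1 / (4 / 3 * a ^ 3))] with l h_energy h_wide
  obtain ⟨A, hA_nonneg, hA_le, hA⟩ :=
    exists_youngPsi_eq (q := 1 / (2 * 2 ^ l)) ha (by positivity) (by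
      rw [div_le_iff₀ (by positivity)] at h_wide ⊢
      linarith)
  have h_height : 1 ≤ a * A ^ 2 * (2 * 2 ^ l) := by
    have h := youngPsi_le_mul_sq hA_nonneg hA_le
    rwa [hA, div_le_iff₀ (by positivity)] at h
  refine ⟨_, indicator_mem_localConstraint ha hA, ?_⟩
  rw [dispersiveEnergy_indicator_sq (by positivity)]
  calc 1 - σ ≤ a * A ^ 2 * (2 * 2 ^ l) * (1 - σ) :=
        le_mul_of_one_le_left (by linarith) h_height
    _ = a * (A ^ 2 * (2 ^ l * (2 * (1 - σ)))) := by ring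
    _ ≤ _ := by gcongr

end Plateau

section Truncation

variable {a c σ δ θ : ℝ} {f : ℝ → ℝ}

theorem integrable_max_abs_sub {B : ℝ} (hB : 0 < B) (hf : MemLp f 2) :
    Integrable fun x => max (|f x| - B) 0 := by
  refine (hf.integrable_sq.div_const B).mono' ?_ (Eventually.of_forall fun x => ?_)
  · exact ((hf.1.norm.sub aestronglyMeasurable_const).sup aestronglyMeasurable_const :)
  · rw [Real.norm_of_nonneg (le_max_right _ _)]
    exact max_abs_sub_le_sq_div hB (f x)

theorem stretchDensity_mul_youngPsi_min_softThreshold_le (ha : 0 < a) (hδ : 0 ≤ δ) (y : ℝ) :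
    stretchDensity (heightB a) (softThreshold δ y)
      * youngPsi a (min (softThreshold δ y) (heightB a)) ≤ youngPsi a y :=
  calc _ ≤ youngPsi a (softThreshold δ y) := stretchDensity_heightB_mul_youngPsi_min_le ha _
    _ ≤ youngPsi a |y| := monotoneOn_youngPsi ha (mem_Ici.2 (softThreshold_nonneg δ y))
        (mem_Ici.2 (abs_nonneg y)) (softThreshold_le_abs hδ y)
    _ = youngPsi a y := youngPsi_abs a y

theorem integrable_stretchDensity_mul_youngPsi_min (ha : 0 < a) (hδ : 0 ≤ δ) (hm : Measurable f)
    (hi : Integrable fun x => youngPsi a (f x)) :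
    Integrable fun x => stretchDensity (heightB a) (softThreshold δ (f x))
      * youngPsi a (min (softThreshold δ (f x)) (heightB a)) := by
  have h_meas : Measurable fun x => stretchDensity (heightB a) (softThreshold δ (f x))
      * youngPsi a (min (softThreshold δ (f x)) (heightB a)) := by fun_prop
  refine hi.mono' h_meas.aestronglyMeasurable (Eventually.of_forall fun x => ?_)
  rw [Real.norm_of_nonneg (mul_nonneg
    (zero_le_one.trans (one_le_stretchDensity (heightB_pos ha).le _)) (youngPsi_nonneg ha _))]
  exact stretchDensity_mul_youngPsi_min_softThreshold_le ha hδ (f x)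

theorem integral_truncation_gain (ha : 0 < a) (hc_nonneg : 0 ≤ c) (hc_lower : 1 - σ ≤ a * c)
    (hc_upper : c ≤ 3 / a) (hσ : 0 ≤ σ) (hσ' : σ ≤ 1 / 10) (hδ : 0 ≤ δ) (hθ : 0 ≤ θ)
    (hm : Measurable f) (hf : MemLp f 2) (hi : Integrable fun x => youngPsi a (f x)) :
    (∫ x, f x ^ 2) - c * (∫ x, youngPsi a (f x)) - (σ + 3 * δ / a) * (∫ x, f x ^ 2)
      + 1 / 5 * (2 * θ * (∫ x, max (|f x| - heightB a) 0)
        - (2 * θ * δ + θ ^ 2) / heightB a ^ 2 * ∫ x, f x ^ 2)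
    ≤ (∫ x, stretchDensity (heightB a) (softThreshold δ (f x))
        * min (softThreshold δ (f x)) (heightB a) ^ 2)
      - c * ∫ x, stretchDensity (heightB a) (softThreshold δ (f x))
        * youngPsi a (min (softThreshold δ (f x)) (heightB a)) := by
  have hB := heightB_pos ha
  have h_sq := hf.integrable_sq
  have h_excess : Integrable fun x => 2 * θ * max (|f x| - heightB a) 0 :=
    (integrable_max_abs_sub hB hf).const_mul _
  have h_main : Integrable fun x => f x ^ 2 - c * youngPsi a (f x) := h_sq.sub (hi.const_mul c)
  have h_loss : Integrable fun x =>
      f x ^ 2 - c * youngPsi a (f x) - (σ + 3 * δ / a) * f x ^ 2 := h_main.sub (h_sq.const_mul _)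
  have h_bonus : Integrable fun x => 1 / 5 * (2 * θ * max (|f x| - heightB a) 0
      - (2 * θ * δ + θ ^ 2) / heightB a ^ 2 * f x ^ 2) :=
    (h_excess.sub (h_sq.const_mul _)).const_mul _
  have h_cut_sq := integrable_stretchDensity_mul_min_sq
    ((measurable_softThreshold δ).comp hm) (memLp_softThreshold hm hf hδ) hB
  have h_cut_psi := integrable_stretchDensity_mul_youngPsi_min ha hδ hm hi
  have h_mono := integral_mono (h_loss.add h_bonus) (h_cut_sq.sub (h_cut_psi.const_mul c))
    fun x => (truncation_gain ha hc_nonneg hc_lower hc_upper hσ hσ' hδ hθ (f x)).trans_eq <| by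
      simp only [Pi.sub_apply, Function.comp_apply]
      ring
  simp only [Pi.add_apply, Pi.sub_apply] at h_mono
  rwa [integral_add h_loss h_bonus, integral_sub h_main (h_sq.const_mul _),
    integral_sub h_sq (hi.const_mul c), integral_const_mul (1 / 5),
    integral_sub h_excess (h_sq.const_mul _), integral_sub h_cut_sq (h_cut_psi.const_mul c),
    integral_const_mul, integral_const_mul, integral_const_mul, integral_const_mul,
    integral_const_mul] at h_mono

/-- The competitor is `f` stretched by `1 / P`, which restores the modular. -/
theorem exists_mem_localConstraint_dispersiveEnergy_sq_le (ha : 0 < a) {P r : ℝ} {l : ℕ}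
    (hm : Measurable f) (hs : ∀ x, f x ≠ 0 → |x| ≤ r)
    (hi : Integrable fun x => youngPsi a (f x)) (hP : ∫ x, youngPsi a (f x) = P)
    (hP_pos : 0 < P) (hP_le : P ≤ 1) (hr : r ≤ P * 2 ^ l) :
    ∃ g ∈ localConstraint a l, dispersiveEnergy f ^ 2 ≤ P * dispersiveEnergy g ^ 2 := by
  have hf₂ := memLp_two_of_integrable_youngPsi ha hm.aestronglyMeasurable hi
  have hf₁ := integrable_of_memLp_two_of_support hf₂ hs
  have hu : 0 < P⁻¹ := inv_pos.2 hP_pos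
  have hgm : Measurable fun x => f (x / P⁻¹) := hm.comp (measurable_id.div_const _)
  have hgi : Integrable fun x => youngPsi a (f (x / P⁻¹)) := hi.comp_div hu.ne'
  refine ⟨fun x => f (x / P⁻¹), mem_localConstraint ha hgm hgi ?_ fun x hx => ?_, ?_⟩
  · rw [Measure.integral_comp_div (fun x => youngPsi a (f x)), abs_of_pos hu, smul_eq_mul, hP,
      inv_mul_cancel₀ hP_pos.ne']
  · have hx_le := (hs _ hx).trans hr
    rwa [div_inv_eq_mul, abs_mul, abs_of_pos hP_pos, mul_comm, mul_le_mul_iff_right₀ hP_pos]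
      at hx_le
  · have h_energy := isGaussianMixture_whithamSymbol_sq.mul_symbolEnergy_le_comp_div
      ((one_le_inv₀ hP_pos).2 hP_le) hf₁ hf₂
    rwa [← dispersiveEnergy_sq hf₁ hf₂, ← dispersiveEnergy_sq (hf₁.comp_div hu.ne')
      (memLp_two_of_integrable_youngPsi ha hgm.aestronglyMeasurable hgi),
      inv_mul_le_iff₀ hP_pos] at h_energy

/-- Truncating `f` costs little energy, while the modular drops in proportion to the mass of `f`
above `heightB a`. -/
theorem exists_truncation_energy_gain {ε η R : ℝ} (ha : 0 < a) (hσ : 0 ≤ σ) (hσ' : σ ≤ 1 / 10)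
    (hδ : 0 < δ) (hθ : 0 ≤ θ) (hR : 0 ≤ R)
    (h_gain : η ≤ 1 / 5 * (2 * θ * ε - (2 * θ * δ + θ ^ 2) / heightB a ^ 2 * (3 / a))
      - (σ + 3 * δ / a) * (3 / a))
    (hm : Measurable f) (hs : ∀ x, f x ≠ 0 → |x| ≤ R)
    (hi : Integrable fun x => youngPsi a (f x)) (h_modular : ∫ x, youngPsi a (f x) ≤ 1)
    (h_energy : 1 - σ ≤ a * dispersiveEnergy f ^ 2)
    (hε : ε ≤ ∫ x, max (|f x| - heightB a) 0) :
    ∃ g : ℝ → ℝ, Measurable g ∧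
      (∀ x, g x ≠ 0 → |x| ≤ 2 * (3 / a / δ ^ 2 + 1) + 2 / heightB a ^ 2 * (3 / a)) ∧
      (Integrable fun x => youngPsi a (g x)) ∧ ∫ x, youngPsi a (g x) ≤ 1 ∧
      dispersiveEnergy f ^ 2 * (∫ x, youngPsi a (g x)) + η ≤ dispersiveEnergy g ^ 2 := by
  have hB := heightB_pos ha
  have hf₂ := memLp_two_of_integrable_youngPsi ha hm.aestronglyMeasurable hi
  have hf₁ := integrable_of_memLp_two_of_support hf₂ hs
  have h_sq : ∫ x, f x ^ 2 ≤ 3 / a := (integral_sq_le_mul_integral_youngPsi ha hf₂ hi).trans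
    (mul_le_of_le_one_right (by positivity) h_modular)
  obtain ⟨g, hgm, hg₂, hgs, h_transport, h_loss⟩ := exists_truncation hm hf₂ hR hs hδ hB
  have hg₁ := integrable_of_memLp_two_of_support hg₂ hgs
  have h_energy_loss := h_loss _ isGaussianMixture_whithamSymbol_sq
  rw [← dispersiveEnergy_sq hf₁ hf₂, ← dispersiveEnergy_sq hg₁ hg₂, whithamSymbol_zero, one_pow,
    mul_one] at h_energy_loss
  have h_density (y : ℝ) : 0 ≤ stretchDensity (heightB a) (softThreshold δ y) :=
    zero_le_one.trans (one_le_stretchDensity hB.le _)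
  have h_cut_psi := integrable_stretchDensity_mul_youngPsi_min ha hδ.le hm hi
  have h_psi := h_transport.integral_comp h_density (measurable_youngPsi a) (youngPsi_nonneg ha)
    (youngPsi_zero ha) hgm h_cut_psi
  have h_sq_g := h_transport.integral_sq h_density hgm <| integrable_stretchDensity_mul_min_sq
    ((measurable_softThreshold δ).comp hm) (memLp_softThreshold hm hf₂ hδ.le) hB
  refine ⟨g, hgm, fun x hx => (hgs x hx).trans (by gcongr), h_transport.integrable_comp h_density
    (measurable_youngPsi a) (youngPsi_nonneg ha) (youngPsi_zero ha) hgm h_cut_psi, ?_, ?_⟩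
  · rw [h_psi]
    exact (integral_mono h_cut_psi hi fun x =>
      stretchDensity_mul_youngPsi_min_softThreshold_le ha hδ.le (f x)).trans h_modular
  · have h := integral_truncation_gain ha (sq_nonneg _) h_energy
      ((dispersiveEnergy_sq_le hf₁ hf₂).trans h_sq) hσ hσ' hδ.le hθ hm hf₂ hi
    rw [← h_psi, ← h_sq_g] at h
    have h_threshold_loss : (σ + 3 * δ / a) * ∫ x, f x ^ 2 ≤ (σ + 3 * δ / a) * (3 / a) := by gcongr
    have h_bonus_loss : (2 * θ * δ + θ ^ 2) / heightB a ^ 2 * ∫ x, f x ^ 2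
        ≤ (2 * θ * δ + θ ^ 2) / heightB a ^ 2 * (3 / a) := by gcongr
    have h_bonus : 2 * θ * ε ≤ 2 * θ * ∫ x, max (|f x| - heightB a) 0 := by gcongr
    have h_modular_energy := mul_le_of_le_one_right (sq_nonneg (dispersiveEnergy f)) h_modular
    linarith

theorem exists_dispersiveEnergy_lt {ε η R : ℝ} (ha : 0 < a) (hσ : 0 ≤ σ) (hσ' : σ ≤ 1 / 10)
    (hδ : 0 < δ) (hθ : 0 ≤ θ) (hR : 0 ≤ R) (hη : 0 < η)
    (h_gain : η ≤ 1 / 5 * (2 * θ * ε - (2 * θ * δ + θ ^ 2) / heightB a ^ 2 * (3 / a))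
      - (σ + 3 * δ / a) * (3 / a))
    (hm : Measurable f) (hs : ∀ x, f x ≠ 0 → |x| ≤ R)
    (hi : Integrable fun x => youngPsi a (f x)) (h_modular : ∫ x, youngPsi a (f x) ≤ 1)
    (h_energy : 1 - σ ≤ a * dispersiveEnergy f ^ 2)
    (hε : ε ≤ ∫ x, max (|f x| - heightB a) 0) {l : ℕ}
    (hl : 2 * (3 / a / δ ^ 2 + 1) + 2 / heightB a ^ 2 * (3 / a) ≤ a * η / 3 * 2 ^ l) :
    ∃ g ∈ localConstraint a l, dispersiveEnergy f < dispersiveEnergy g := by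
  obtain ⟨g, hgm, hgs, hgi, hP_le, hg_energy⟩ := exists_truncation_energy_gain ha hσ hσ' hδ hθ hR
    h_gain hm hs hi h_modular h_energy hε
  set P := ∫ x, youngPsi a (g x) with hP
  have hg₂ := memLp_two_of_integrable_youngPsi ha hgm.aestronglyMeasurable hgi
  have hP_nonneg : 0 ≤ P := integral_nonneg fun x => youngPsi_nonneg ha _
  have hP_lower : a * η / 3 ≤ P := by
    have h_energy_le := (dispersiveEnergy_sq_le
      (integrable_of_memLp_two_of_support hg₂ hgs) hg₂).trans
      (integral_sq_le_mul_integral_youngPsi ha hg₂ hgi)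
    calc a * η / 3 ≤ a * (3 / a * P) / 3 := by
          gcongr
          linarith [mul_nonneg (sq_nonneg (dispersiveEnergy f)) hP_nonneg]
      _ = P := by field_simp
  have hP_pos : 0 < P := lt_of_lt_of_le (by positivity) hP_lower
  obtain ⟨h, hh, h_le⟩ := exists_mem_localConstraint_dispersiveEnergy_sq_le ha hgm hgs hgi hP.symm
    hP_pos hP_le (hl.trans (by gcongr))
  refine ⟨h, hh, lt_of_pow_lt_pow_left₀ 2 (dispersiveEnergy_nonneg _) ?_⟩
  refine lt_of_mul_lt_mul_left ?_ hP_nonneg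
  linarith

end Truncation

/-- Completing the square suggests `θ = ε B² / (2S)`, where `S` bounds the squared `L²` norm; the
remaining errors are then made small compared with `θ ε`. -/
theorem exists_gain_parameters {a B S ε : ℝ} (ha : 0 < a) (hB : 0 < B) (hS : 0 < S) (hε : 0 < ε) :
    ∃ σ δ θ η : ℝ, 0 < σ ∧ σ ≤ 1 / 10 ∧ 0 < δ ∧ 0 ≤ θ ∧ 0 < η ∧
      η ≤ 1 / 5 * (2 * θ * ε - (2 * θ * δ + θ ^ 2) / B ^ 2 * S) - (σ + 3 * δ / a) * S := by
  set θ := ε * B ^ 2 / (2 * S) with hθ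
  set η := θ * ε / 10 with hη
  set δ := min (ε * B ^ 2 / (4 * S)) (η * a / (6 * S))
  set σ := min (1 / 10) (η / (2 * S))
  refine ⟨σ, δ, θ, η, by positivity, min_le_left _ _, by positivity, by positivity, by positivity,
    ?_⟩
  have h_square : θ ^ 2 / B ^ 2 * S = θ * ε / 2 := by
    rw [hθ]
    field_simp
  have h_cross : 2 * θ * δ / B ^ 2 * S ≤ θ * ε / 2 := by
    calc 2 * θ * δ / B ^ 2 * S ≤ 2 * θ * (ε * B ^ 2 / (4 * S)) / B ^ 2 * S := by
          gcongr
          exact min_le_left _ _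
      _ = θ * ε / 2 := by field_simp; ring
  have h_threshold : 3 * δ / a * S ≤ η / 2 := by
    calc 3 * δ / a * S ≤ 3 * (η * a / (6 * S)) / a * S := by
          gcongr
          exact min_le_right _ _
      _ = η / 2 := by field_simp; ring
  have h_plateau : σ * S ≤ η / 2 := by
    calc σ * S ≤ η / (2 * S) * S := by
          gcongr
          exact min_le_right _ _
      _ = η / 2 := by field_simp
  rw [add_div, add_mul, add_mul]
  linarith

theorem eventually_integral_max_abs_sub_heightB_lt {a ε : ℝ} (ha : 0 < a) (hε : 0 < ε) :
    ∀ᶠ l : ℕ in atTop, ∀ f, IsLocalMaximiser a l f → ∫ x, max (|f x| - heightB a) 0 < ε := by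
  obtain ⟨σ, δ, θ, η, hσ, hσ', hδ, hθ, hη, h_gain⟩ :=
    exists_gain_parameters ha (heightB_pos ha) (by positivity : 0 < 3 / a) hε
  have h_pow : Tendsto (fun l : ℕ => a * η / 3 * (2 : ℝ) ^ l) atTop atTop :=
    (tendsto_pow_atTop_atTop_of_one_lt one_lt_two).const_mul_atTop (by positivity)
  filter_upwards [eventually_exists_dispersiveEnergy_ge ha hσ (by linarith),
    h_pow.eventually_ge_atTop _] with l ⟨F, hF, hF_energy⟩ hl f ⟨hf, hf_max⟩
  by_contra! h_mass
  obtain ⟨g, hgm, hfg, hgs, hgi, hg_modular⟩ := exists_measurable_of_mem_localConstraint ha hf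
  have hg_mass : ε ≤ ∫ x, max (|g x| - heightB a) 0 :=
    h_mass.trans_eq (integral_congr_ae (hfg.fun_comp fun y => max (|y| - heightB a) 0))
  have h_energy_eq := dispersiveEnergy_congr_ae hfg
  have hg_energy : 1 - σ ≤ a * dispersiveEnergy g ^ 2 := by
    have h_max : dispersiveEnergy F ≤ dispersiveEnergy f := hf_max hF
    rw [← h_energy_eq]
    have := dispersiveEnergy_nonneg F
    exact hF_energy.trans (by gcongr)
  obtain ⟨h, hh, h_lt⟩ := exists_dispersiveEnergy_lt ha hσ.le hσ' hδ hθ (by positivity) hη h_gain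
    hgm hgs hgi hg_modular hg_energy hg_mass hl
  rw [← h_energy_eq] at h_lt
  exact h_lt.not_ge (hf_max hh)

section UpperLevelSet

variable {f : ℝ → ℝ} {B : ℝ}

theorem abs_sub_le_max_abs_sub {y : ℝ} (hy : B ≤ y) : |y - B| ≤ max (|y| - B) 0 := by
  rw [abs_of_nonneg (sub_nonneg.2 hy)]
  exact le_max_of_le_left (sub_le_sub_right (le_abs_self y) B)

theorem integrableOn_abs_sub (hB : 0 < B) (hf : MemLp f 2) :
    IntegrableOn (fun x => |f x - B|) {x | B ≤ f x} := by
  refine (integrable_max_abs_sub hB hf).integrableOn.mono'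
    (hf.1.sub aestronglyMeasurable_const).norm.restrict ?_
  refine (ae_restrict_iff'₀ (nullMeasurableSet_le aemeasurable_const hf.1.aemeasurable)).2
    (Eventually.of_forall fun x hx => ?_)
  rw [Real.norm_eq_abs, abs_abs]
  exact abs_sub_le_max_abs_sub hx

theorem setIntegral_abs_sub_le (hB : 0 < B) (hf : MemLp f 2) :
    ∫ x in {x | B ≤ f x}, |f x - B| ≤ ∫ x, max (|f x| - B) 0 :=
  (setIntegral_mono_on₀ (integrableOn_abs_sub hB hf) (integrable_max_abs_sub hB hf).integrableOn
    (nullMeasurableSet_le aemeasurable_const hf.1.aemeasurable)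
    fun _ hx => abs_sub_le_max_abs_sub hx).trans <|
  setIntegral_le_integral (integrable_max_abs_sub hB hf)
    (Eventually.of_forall fun _ => le_max_right _ _)

end UpperLevelSet

theorem mainTheorem3 (α : ℝ) (hα : 0 < α) :
    (0 < heightB α ∧ |heightB α - 1.48 * α| ≤ 0.005 * α ∧
      ∀ y : ℝ, 0 < y →
        (2 * youngPsi α y = y * deriv (youngPsi α) y ↔ y = heightB α)) ∧
    ∀ ε : ℝ, 0 < ε → ∃ l₀ : ℕ, ∀ l : ℕ, l₀ < l → ∀ f : ℝ → ℝ, IsLocalMaximiser α l f →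
      IntegrableOn (fun x => |f x - heightB α|) {x | heightB α ≤ f x} ∧
      ∫ x in {x | heightB α ≤ f x}, |f x - heightB α| < ε := by
  have hB := heightB_pos hα
  refine ⟨⟨hB, abs_heightB_sub_le hα, fun y hy => two_mul_youngPsi_eq_iff hα hy⟩, fun ε hε => ?_⟩
  obtain ⟨l₀, hl₀⟩ := eventually_atTop.1 (eventually_integral_max_abs_sub_heightB_lt hα hε)
  refine ⟨l₀, fun l hl f hf => ?_⟩
  have hf_memLp : MemLp f 2 := MemOrlicz.memLp_two hα hf.1.1
  exact ⟨integrableOn_abs_sub hB hf_memLp,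
    (setIntegral_abs_sub_le hB hf_memLp).trans_lt (hl₀ l hl.le f hf)⟩
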